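/- **Setting.** A *signature* is a real-valued function of finitely many Boolean variables, each of which is either on the left hand side (LHS) or on the right hand side (RHS). $[x_0,\dots,x_k]$ denotes the symmetric signature of arity $k$ whose value on inputs of Hamming weight $w$ is $x_w$, and $(=_3)=[1,0,0,1]$. For finite sets $\mathcal F,\mathcal G$ of signatures with all variables on the LHS, respectively on the RHS, an instance of $\mathrm{Holant}(\mathcal F\mid\mathcal G)$ is a bipartite signature grid: a finite bipartite graph (parallel edges allowed) with the vertices of one side labelled by elements of $\mathcal F$ and those of the other side by elements of $\mathcal G$, each of the right arity. The problem is to compute $\sum_{\sigma:E\to\{0,1\}}\prod_v f_v(\sigma|_{E(v)})$. A binary *straddled* signature has one LHS variable (row index of its $2\times2$ matrix) and one RHS variable (column index). It may be added to a Holant problem; then every edge joins an LHS variable to an RHS variable. It is *degenerate* if its determinant is $0$. We write $A\le_T B$ if $A$ can be solved in polynomial time with an oracle for $B$. The signatures are fixed, and numbers are exact: they are elements of the field generated over $\mathbb Q$ by finitely many fixed real constants, here $a,b,c,\Delta$, given as rational expressions (formulas without division by zero) in these constants. **Lemma.** Let $a,b,c\ge 0$ be real with $a\ne0$, let $\Delta=\sqrt{(1-c)^2+4ab}$,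 and assume $\Delta>0$. Let $x=\frac{\Delta-(1-c)}{2a}$ and $y=\frac{\Delta+(1-c)}{2a}$. Let $G_1$ be the straddled gadget obtained by joining one copy of $[1,a,b,c]$ (on the LHS) and one copy of $(=_3)$ (on the RHS) by two edges, leaving one dangling edge at each. Its signature matrix is $$G_1=\begin{pmatrix}1&b\\a&c\end{pmatrix}=P\begin{pmatrix}\lambda&0\\0&\mu\end{pmatrix}P^{-1},\qquad P=\begin{pmatrix}-x&y\\1&1\end{pmatrix},\quad \lambda=\tfrac{-\Delta+(1+c)}2,\quad \mu=\tfrac{\Delta+(1+c)}2,$$ where $P$ is invertible. The straddled signature $$D=P\begin{pmatrix}0&0\\0&1\end{pmatrix}P^{-1}=\frac1{x+y}\begin{pmatrix}y&xy\\1&x\end{pmatrix}$$ is degenerate and can be interpolated: the problem $\mathrm{Holant}([1,a,b,c]\mid(=_3))$ with $D$ added is $\le_T \mathrm{Holant}([1,a,b,c]\mid(=_3))$. Consequently one obtains the unary signature $[1,x]$ on the RHS, and likewise the unary signature $[y,1]$ on the LHS: $$\mathrm{Holant}([1,a,b,c]\mid\{(=_3),[1,x]\})\le_T\mathrm{Holant}([1,a,b,c]\mid(=_3)),$$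 $$\mathrm{Holant}(\{[1,a,b,c],[y,1]\}\mid(=_3))\le_T\mathrm{Holant}([1,a,b,c]\mid(=_3)).$$ -/

import Mathlib

namespace BipHolant

/-! ### Signatures and bipartite signature grids -/

/-- Finite binary trees (S-expressions): the values handled by programs, and the names of edges. -/
inductive Data where
  | nil : Data
  | cons : Data → Data → Data
deriving DecidableEq

/-- A real valued constraint function (signature) with `l` Boolean variables on the left hand side
(LHS) and `r` Boolean variables on the right hand side (RHS). Its value at `u : {0,1}^l`,
`v : {0,1}^r` is `val u v` (`true` is `1`); only lists of lengths `l` and `r` matter.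
A vertex on the LHS carries a signature with `r = 0`, a vertex on the RHS one with `l = 0`, and a
straddled signature has variables of both kinds. -/
structure Sig where
  l : ℕ
  r : ℕ
  val : List Bool → List Bool → ℝ

/-- The symmetric signature `[x₀, …, x_k]` of arity `k` on the LHS: its value on an input of Hamming
weight `w` is `x_w`. -/
def symLeft (xs : List ℝ) : Sig where
  l := xs.length - 1
  r := 0
  val u _ := xs.getD (u.count true) 0

/-- The symmetric signature `[x₀, …, x_k]` of arity `k` on the RHS. -/
def symRight (xs : List ℝ) : Sig where
  l := 0
  r := xs.length - 1
  val _ v := xs.getD (v.count true) 0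

/-- The ternary equality `(=₃) = [1,0,0,1]`, on the RHS. -/
def eq3 : Sig := symRight [1, 0, 0, 1]

/-- A Boolean value as an index of a `2 × 2` signature matrix. -/
def bit (u : Bool) : Fin 2 := if u then 1 else 0

/-- The binary straddled signature with signature matrix `M`: the row index is the variable on the
LHS, the column index is the variable on the RHS. -/
def straddled (M : Matrix (Fin 2) (Fin 2) ℝ) : Sig where
  l := 1
  r := 1
  val u v := M (bit (u.headD false)) (bit (v.headD false))

/-- A vertex of a signature grid: the index of its signature in the list of available signatures,
and the edges attached to its LHS variables and to its RHS variables, in order. -/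
structure Vertex where
  label : ℕ
  lEnds : List Data
  rEnds : List Data

/-- A signature grid, given by the list of its vertices. -/
abbrev Grid := List Vertex

namespace Grid

/-- All edges, listed by the LHS variables to which they are attached. -/
def lEnds (Ω : Grid) : List Data := Ω.flatMap Vertex.lEnds

/-- All edges, listed by the RHS variables to which they are attached. -/
def rEnds (Ω : Grid) : List Data := Ω.flatMap Vertex.rEnds

/-- `Ω` is a bipartite signature grid over the signatures `S`: every vertex has a signature from `S`
and as many ends as that signature has variables, and every edge joins exactly one LHS variable to
exactly one RHS variable. Parallel edges are allowed. -/
def WellFormed (S : List Sig) (Ω : Grid) : Prop :=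
  (∀ v ∈ Ω, ∃ s, S[v.label]? = some s ∧ v.lEnds.length = s.l ∧ v.rEnds.length = s.r) ∧
    Ω.lEnds.Nodup ∧ Ω.lEnds.Perm Ω.rEnds

end Grid

/-- The value of the signature at `v` under the edge assignment `σ`. -/
noncomputable def Vertex.weight (S : List Sig) (σ : Data → Bool) (v : Vertex) : ℝ :=
  match S[v.label]? with
  | some s => s.val (v.lEnds.map σ) (v.rEnds.map σ)
  | none => 0

/-- The Holant value: the sum over all assignments of `0` and `1` to the edges of the product of the
values of all vertices. An assignment is given by the set `T` of the edges of value `1`. -/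
noncomputable def holant (S : List Sig) (Ω : Grid) : ℝ :=
  ∑ T ∈ Ω.lEnds.toFinset.powerset, (Ω.map (Vertex.weight S (fun e => decide (e ∈ T)))).prod

/-- The signature matrix of the gadget in which a ternary LHS signature `f` and a ternary RHS
signature `g` are joined by two internal edges (with values `s` and `t`), leaving one dangling edge
at `f` (row index) and one dangling edge at `g` (column index). -/
noncomputable def gadgetG1 (f g : Sig) : Matrix (Fin 2) (Fin 2) ℝ :=
  Matrix.of fun i j =>
    ∑ s : Bool, ∑ t : Bool, f.val [decide (i = 1), s, t] [] * g.val [] [s, t, decide (j = 1)]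

/-! ### Encodings -/

namespace Data

/-- The number of nodes of a tree. -/
def size : Data → ℕ
  | nil => 1
  | cons d e => d.size + e.size + 1

/-- A list, as a tree. -/
def ofList : List Data → Data
  | [] => nil
  | d :: ds => cons d (ofList ds)

/-- A number in unary; used only for boundedly many tags and indices. -/
def ofNat : ℕ → Data
  | 0 => nil
  | n + 1 => cons nil (ofNat n)

end Data

/-- A vertex, as a tree. -/
def Vertex.toData (v : Vertex) : Data :=
  Data.cons (Data.ofNat v.label) (Data.cons (Data.ofList v.lEnds) (Data.ofList v.rEnds))

/-- A signature grid, as a tree. -/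
def Grid.toData (Ω : Grid) : Data := Data.ofList (List.map Vertex.toData Ω)

/-! ### Notations for real numbers

The weights of a Holant problem are fixed real numbers, and all the values that occur lie in the
field `ℚ(θ)` generated by finitely many fixed real numbers `θ`. An element of `ℚ(θ)` is given to a
program, or returned by it, as a rational expression (a formula, not a circuit) in `θ`. The size of
a number is the size of the formula; an integer `N` has a formula of size `O(log (2 + |N|))` by
Horner's rule. -/

/-- Rational expressions in the constants `θ₀, θ₁, …`. -/
inductive Formula where
  | one : Formula
  | const : ℕ → Formula
  | add : Formula → Formula → Formula
  | sub : Formula → Formula → Formula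
  | mul : Formula → Formula → Formula
  | div : Formula → Formula → Formula

/-- `Denotes θ e r`: the expression `e` is defined at `θ` (no division by zero) with value `r`. -/
inductive Denotes (θ : List ℝ) : Formula → ℝ → Prop where
  | one : Denotes θ Formula.one 1
  | const {i : ℕ} {r : ℝ} : θ[i]? = some r → Denotes θ (Formula.const i) r
  | add {e f : Formula} {r s : ℝ} :
      Denotes θ e r → Denotes θ f s → Denotes θ (Formula.add e f) (r + s)
  | sub {e f : Formula} {r s : ℝ} :
      Denotes θ e r → Denotes θ f s → Denotes θ (Formula.sub e f) (r - s)
  | mul {e f : Formula} {r s : ℝ} :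
      Denotes θ e r → Denotes θ f s → Denotes θ (Formula.mul e f) (r * s)
  | div {e f : Formula} {r s : ℝ} :
      Denotes θ e r → Denotes θ f s → s ≠ 0 → Denotes θ (Formula.div e f) (r / s)

/-- An expression, as a tree. -/
def Formula.toData : Formula → Data
  | one => Data.cons (Data.ofNat 0) Data.nil
  | const i => Data.cons (Data.ofNat 1) (Data.ofNat i)
  | add e f => Data.cons (Data.ofNat 2) (Data.cons e.toData f.toData)
  | sub e f => Data.cons (Data.ofNat 3) (Data.cons e.toData f.toData)
  | mul e f => Data.cons (Data.ofNat 4) (Data.cons e.toData f.toData)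
  | div e f => Data.cons (Data.ofNat 5) (Data.cons e.toData f.toData)

/-- The tree `d` is a name of the real number `r` over the constants `θ`. -/
def IsName (θ : List ℝ) (d : Data) (r : ℝ) : Prop :=
  ∃ e : Formula, e.toData = d ∧ Denotes θ e r

/-! ### Oracle programs with a step count -/

/-- Programs over variables `0, 1, 2, …` that hold trees. -/
inductive Cmd where
  | setNil (x : ℕ) : Cmd
  | copy (x y : ℕ) : Cmd
  | cons (x y z : ℕ) : Cmd
  | head (x y : ℕ) : Cmd
  | tail (x y : ℕ) : Cmd
  | query (x y : ℕ) : Cmd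
  | seq (p q : Cmd) : Cmd
  | cond (x : ℕ) (p q : Cmd) : Cmd
  | loop (x : ℕ) (p : Cmd) : Cmd

/-- The contents of the variables. -/
abbrev Store := ℕ → Data

/-- The first component of a pair (`nil` for `nil`). -/
def Data.fst : Data → Data
  | nil => nil
  | cons d _ => d

/-- The second component of a pair (`nil` for `nil`). -/
def Data.snd : Data → Data
  | nil => nil
  | cons _ e => e

/-- `Run O p σ t τ`: with oracle `O`, the program `p` started in the store `σ` halts in the store `τ`
after `t` steps. An assignment costs the size of the tree that is written (trees are copied, never
shared), an oracle call costs the sizes of the query and of the answer, a test costs one step. So the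
running time is, up to a polynomial, that of a multitape oracle Turing machine.
`cond x p q` runs `p` if `x` is not `nil` and `q` if it is; `loop x p` repeats `p` while `x` is not
`nil`. -/
inductive Run (O : Data → Data) : Cmd → Store → ℕ → Store → Prop where
  | setNil (x : ℕ) (σ : Store) :
      Run O (Cmd.setNil x) σ (1 + Data.nil.size) (Function.update σ x Data.nil)
  | copy (x y : ℕ) (σ : Store) :
      Run O (Cmd.copy x y) σ (1 + (σ y).size) (Function.update σ x (σ y))
  | cons (x y z : ℕ) (σ : Store) :
      Run O (Cmd.cons x y z) σ (1 + (Data.cons (σ y) (σ z)).size)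
        (Function.update σ x (Data.cons (σ y) (σ z)))
  | head (x y : ℕ) (σ : Store) :
      Run O (Cmd.head x y) σ (1 + (σ y).fst.size) (Function.update σ x (σ y).fst)
  | tail (x y : ℕ) (σ : Store) :
      Run O (Cmd.tail x y) σ (1 + (σ y).snd.size) (Function.update σ x (σ y).snd)
  | query (x y : ℕ) (σ : Store) :
      Run O (Cmd.query x y) σ (1 + (σ y).size + (O (σ y)).size) (Function.update σ x (O (σ y)))
  | seq {p q : Cmd} {σ τ ρ : Store} {s t : ℕ} :
      Run O p σ s τ → Run O q τ t ρ → Run O (Cmd.seq p q) σ (s + t) ρ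
  | condTrue {x : ℕ} {p q : Cmd} {σ τ : Store} {t : ℕ} :
      σ x ≠ Data.nil → Run O p σ t τ → Run O (Cmd.cond x p q) σ (1 + t) τ
  | condFalse {x : ℕ} {p q : Cmd} {σ τ : Store} {t : ℕ} :
      σ x = Data.nil → Run O q σ t τ → Run O (Cmd.cond x p q) σ (1 + t) τ
  | loopEnd {x : ℕ} {p : Cmd} {σ : Store} :
      σ x = Data.nil → Run O (Cmd.loop x p) σ 1 σ
  | loopStep {x : ℕ} {p : Cmd} {σ τ ρ : Store} {s t : ℕ} :
      σ x ≠ Data.nil → Run O p σ s τ → Run O (Cmd.loop x p) τ t ρ →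
        Run O (Cmd.loop x p) σ (1 + s + t) ρ

/-- The initial store: the input in variable `0`, all other variables `nil`. -/
def start (d : Data) : Store := fun x => if x = 0 then d else Data.nil

/-! ### Holant problems and polynomial time Turing reductions -/

/-- A computational problem with real values: `A d r` says that `d` is an instance with answer `r`. -/
abbrev Problem := Data → ℝ → Prop

/-- The problem of computing the Holant value of a bipartite signature grid over `S`. The list `S`
holds the signatures that are allowed on the LHS, those allowed on the RHS, and the straddled ones. -/
def Holant (S : List Sig) : Problem := fun d r =>
  ∃ Ω : Grid, Ω.WellFormed S ∧ Ω.toData = d ∧ r = holant S Ω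

/-- The oracle `O` solves the problem `B`: on each instance it returns some name, over the constants
`θ`, of the answer, and its answers have size at most `q` of the size of the query. -/
def Solves (θ : List ℝ) (q : Polynomial ℕ) (O : Data → Data) (B : Problem) : Prop :=
  (∀ d, (O d).size ≤ q.eval d.size) ∧ ∀ d r, B d r → IsName θ (O d) r

/-- `A ≤_T B`: some program computes names of the answers of `A` in polynomial time from any oracle
that solves `B` (with answers of polynomial size). -/
def PolyTimeTuringReducible (θ : List ℝ) (A B : Problem) : Prop :=
  ∃ c : Cmd, ∀ q : Polynomial ℕ, ∃ p : Polynomial ℕ, ∀ O : Data → Data, Solves θ q O B →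
    ∀ d r, A d r → ∃ t τ, Run O c (start d) t τ ∧ t ≤ p.eval d.size ∧ IsName θ (τ 0) r

end BipHolant

open BipHolant

/-!
A bipartite grid `Ω` over `[1, a, b, c]`, `(=₃)` and the straddled signature `D` is reduced to
grids without `D` by interpolation. Write `G₁ = P diag(l, m) P⁻¹`. Then `|l| < m`, since
`m - l = Δ > 0` and `m + l = 1 + c > 0`, and with `ρ = l / m` and `D' = P diag(1, 0) P⁻¹` one has
`G₁ ^ k = m ^ k (D + ρ ^ k D')` (`pow_conj_diagonal`). If `n` vertices of `Ω` carry `D`, then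
replacing them by chains of `k` copies of the gadget `G₁` gives a grid (`holant_expand`) with the
Holant value `m ^ (k n) p(ρ ^ k)`, where `p` is a polynomial of degree at most `n` that does not
depend on `k` (`exists_polynomial_holant`), and `p(0)` is the value of `Ω`. Since `|ρ| < 1`,
Lagrange interpolation at the nodes `ρ ^ 2, …, ρ ^ (N + 2)`, for any `N ≥ n`, recovers `p(0)`; the
coefficients are products of the numbers `1 / (1 - ρ ^ i)` and `ρ ^ i / (ρ ^ i - 1)`, and in this
form the formula is true for `ρ = 0` as well (`eval_zero_eq_sum`). As numbers are returned as
expressions, the program only has to write this formula down, with the answers of the oracle inside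
(`isName_interpolateF`).

For the unary signatures one uses that `D` is, up to the factor `κ = 1 / (x + y)`, the product of
`[y, 1]` in the variable on the LHS and `[1, x]` in the variable on the RHS. So a vertex with
`[1, x]` is replaced by one with `D`, whose variable on the LHS gets a new edge. All other
signatures being ternary, the number of new edges is divisible by three, and they are attached in
triples to new vertices with `(=₃)`. Every triple multiplies the value by the constant
`κ³ (y³ + 1) ≠ 0` (`holant_splitRight`). For `[y, 1]` the new edges are attached to copies of
`[1, a, b, c]`, and the constant is `κ³ (1 + 3 a x + 3 b x² + c x³) ≠ 0` (`holant_splitLeft`).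

For the running time, `PolyTime` is a class of functions on trees that is closed under composition,
case distinction, oracle calls and, if the values grow slowly enough (`AddsPoly`), under primitive
recursion along lists (`PolyTime.fold`). The reductions are functions of this class, built from
these operations, so that no program has to be written out.
-/

namespace BipHolant

/-! ### Polynomial time functions on trees -/

theorem eval_mono_nat (p : Polynomial ℕ) {m n : ℕ} (h : m ≤ n) : p.eval m ≤ p.eval n := by
  rw [Polynomial.eval_eq_sum_range, Polynomial.eval_eq_sum_range]
  gcongr

theorem Data.one_le_size (d : Data) : 1 ≤ d.size := by
  cases d <;> simp [Data.size]

theorem Data.size_fst_le (d : Data) : d.fst.size ≤ d.size := by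
  cases d <;> simp [Data.size, Data.fst]; omega

theorem Data.size_snd_le (d : Data) : d.snd.size ≤ d.size := by
  cases d <;> simp [Data.size, Data.snd]; omega

/-- The answers of the oracle `O` have size at most `q` of the size of the query. -/
def PolyAnswers (q : Polynomial ℕ) (O : Data → Data) : Prop :=
  ∀ d, (O d).size ≤ q.eval d.size

/-- From the store `σ` the program `p` puts `v` into variable `k` within `T` steps, and it leaves
the variables below `k` as they are. The variables above `k` serve as scratch space, on whose
initial contents nothing is assumed. -/
def Computes (O : Data → Data) (p : Cmd) (k : ℕ) (σ : Store) (v : Data) (T : ℕ) : Prop :=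
  ∃ t τ, Run O p σ t τ ∧ t ≤ T ∧ τ k = v ∧ ∀ i < k, τ i = σ i

/-- A function on trees, relative to an oracle, is polynomial time computable. The program comes in
versions `c k` for all `k`, where `c k` has its input and its output in variable `k` and works in
the variables above `k`; so programs can be composed without renaming variables. -/
def PolyTime (F : (Data → Data) → Data → Data) : Prop :=
  ∃ c : ℕ → Cmd, ∀ q : Polynomial ℕ, ∃ p : Polynomial ℕ, ∀ O, PolyAnswers q O →
    (∀ k σ, Computes O (c k) k σ (F O (σ k)) (p.eval (σ k).size)) ∧
      ∀ d, (F O d).size ≤ p.eval d.size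

namespace PolyTime

variable {F G H : (Data → Data) → Data → Data}

/-- The output of a polynomial time function has polynomial size. -/
theorem size_le (hF : PolyTime F) (q : Polynomial ℕ) :
    ∃ p : Polynomial ℕ, ∀ O, PolyAnswers q O → ∀ d, (F O d).size ≤ p.eval d.size := by
  obtain ⟨c, hc⟩ := hF
  obtain ⟨p, hp⟩ := hc q
  exact ⟨p, fun O hO => (hp O hO).2⟩

theorem id : PolyTime fun _ d => d :=
  ⟨fun k => Cmd.copy k k, fun _ => ⟨Polynomial.X + 1, fun O _ =>
    ⟨fun k σ => ⟨_, _, Run.copy k k σ, by simp; omega, by simp, fun i hi => by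
      simp [hi.ne]⟩, fun d => by simp⟩⟩⟩

theorem nil : PolyTime fun _ _ => Data.nil :=
  ⟨fun k => Cmd.setNil k, fun _ => ⟨2, fun O _ =>
    ⟨fun k σ => ⟨_, _, Run.setNil k σ, by simp [Data.size], by simp, fun i hi => by
      simp [hi.ne]⟩, fun d => by simp [Data.size]⟩⟩⟩

theorem comp (hG : PolyTime G) (hF : PolyTime F) : PolyTime fun O d => G O (F O d) := by
  obtain ⟨c, hc⟩ := hF
  obtain ⟨c', hc'⟩ := hG
  refine ⟨fun k => Cmd.seq (c k) (c' k), fun q => ?_⟩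
  obtain ⟨p, hp⟩ := hc q
  obtain ⟨p', hp'⟩ := hc' q
  refine ⟨p + p'.comp p, fun O hO => ⟨fun k σ => ?_, fun d => ?_⟩⟩
  · obtain ⟨t, τ, hr, ht, hv, hl⟩ := (hp O hO).1 k σ
    obtain ⟨t', τ', hr', ht', hv', hl'⟩ := (hp' O hO).1 k τ
    rw [hv] at ht' hv'
    refine ⟨_, _, Run.seq hr hr', ?_, hv', fun i hi => by rw [hl' i hi, hl i hi]⟩
    have := eval_mono_nat p' ((hp O hO).2 (σ k))
    simp only [Polynomial.eval_add, Polynomial.eval_comp]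
    omega
  · have := eval_mono_nat p' ((hp O hO).2 d)
    have := (hp' O hO).2 (F O d)
    simp only [Polynomial.eval_add, Polynomial.eval_comp]
    omega

theorem fst (hF : PolyTime F) : PolyTime fun O d => (F O d).fst :=
  comp (G := fun _ d => d.fst) ⟨fun k => Cmd.head k k, fun _ => ⟨Polynomial.X + 1, fun O _ =>
    ⟨fun k σ => ⟨_, _, Run.head k k σ, by have := (σ k).size_fst_le; simp; omega, by simp,
      fun i hi => by simp [hi.ne]⟩, fun d => by have := d.size_fst_le; simp; omega⟩⟩⟩ hF

theorem snd (hF : PolyTime F) : PolyTime fun O d => (F O d).snd :=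
  comp (G := fun _ d => d.snd) ⟨fun k => Cmd.tail k k, fun _ => ⟨Polynomial.X + 1, fun O _ =>
    ⟨fun k σ => ⟨_, _, Run.tail k k σ, by have := (σ k).size_snd_le; simp; omega, by simp,
      fun i hi => by simp [hi.ne]⟩, fun d => by have := d.size_snd_le; simp; omega⟩⟩⟩ hF

theorem query (hF : PolyTime F) : PolyTime fun O d => O (F O d) :=
  comp (G := fun O d => O d) ⟨fun k => Cmd.query k k, fun q => ⟨Polynomial.X + q + 1, fun O hO =>
    ⟨fun k σ => ⟨_, _, Run.query k k σ, by have := hO (σ k); simp; omega, by simp,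
      fun i hi => by simp [hi.ne]⟩, fun d => by have := hO d; simp; omega⟩⟩⟩ hF

theorem cons (hF : PolyTime F) (hG : PolyTime G) :
    PolyTime fun O d => Data.cons (F O d) (G O d) := by
  obtain ⟨c, hc⟩ := hF
  obtain ⟨c', hc'⟩ := hG
  refine ⟨fun k => Cmd.seq (Cmd.copy (k + 1) k) (Cmd.seq (c (k + 1)) (Cmd.seq (Cmd.copy (k + 2) k)
    (Cmd.seq (c' (k + 2)) (Cmd.cons k (k + 1) (k + 2))))), fun q => ?_⟩
  obtain ⟨p, hp⟩ := hc q
  obtain ⟨p', hp'⟩ := hc' q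
  refine ⟨2 * p + 2 * p' + 2 * Polynomial.X + 4, fun O hO => ⟨fun k σ => ?_, fun d => ?_⟩⟩
  · obtain ⟨t, τ, hr, ht, hv, hl⟩ :=
      (hp O hO).1 (k + 1) (Function.update σ (k + 1) (σ k))
    have hk : τ k = σ k := by rw [hl k (by omega)]; simp
    obtain ⟨t', τ', hr', ht', hv', hl'⟩ :=
      (hp' O hO).1 (k + 2) (Function.update τ (k + 2) (τ k))
    simp only [Function.update_self, hk] at ht hv ht' hv' hr' hl'
    have hv1 : τ' (k + 1) = F O (σ k) := by rw [hl' _ (by omega)]; simpa using hv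
    refine ⟨_, _, Run.seq (Run.copy _ _ _) (Run.seq hr (Run.seq (Run.copy _ _ _) (Run.seq
      (by rw [hk]; exact hr') (Run.cons _ _ _ _)))), ?_, by simp [hv1, hv'], fun i hi => ?_⟩
    · rw [hv1, hv', hk]
      have := (hp O hO).2 (σ k)
      have := (hp' O hO).2 (σ k)
      simp only [Polynomial.eval_add, Polynomial.eval_mul, Polynomial.eval_X,
        Polynomial.eval_ofNat, Data.size]
      omega
    · rw [Function.update_of_ne (by omega), hl' i (by omega), Function.update_of_ne (by omega),
        hl i (by omega), Function.update_of_ne (by omega)]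
  · have := (hp O hO).2 d
    have := (hp' O hO).2 d
    simp only [Polynomial.eval_add, Polynomial.eval_mul, Polynomial.eval_X,
      Polynomial.eval_ofNat, Data.size]
    omega

theorem const (v : Data) : PolyTime fun _ _ => v := by
  induction v with
  | nil => exact nil
  | cons d e hd he => exact cons hd he

theorem ite (hF : PolyTime F) (hG : PolyTime G) (hH : PolyTime H) :
    PolyTime fun O d => if F O d = Data.nil then G O d else H O d := by
  obtain ⟨c, hc⟩ := hF
  obtain ⟨c', hc'⟩ := hG
  obtain ⟨c'', hc''⟩ := hH
  refine ⟨fun k => Cmd.seq (Cmd.copy (k + 1) k) (Cmd.seq (c (k + 1))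
    (Cmd.cond (k + 1) (c'' k) (c' k))), fun q => ?_⟩
  obtain ⟨p, hp⟩ := hc q
  obtain ⟨p', hp'⟩ := hc' q
  obtain ⟨p'', hp''⟩ := hc'' q
  refine ⟨p + p' + p'' + Polynomial.X + 4, fun O hO => ⟨fun k σ => ?_, fun d => ?_⟩⟩
  · obtain ⟨t, τ, hr, ht, hv, hl⟩ :=
      (hp O hO).1 (k + 1) (Function.update σ (k + 1) (σ k))
    have hlow : ∀ i ≤ k, τ i = σ i := fun i hi => by
      rw [hl i (by omega), Function.update_of_ne (by omega)]
    simp only [Function.update_self] at ht hv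
    simp only [Polynomial.eval_add, Polynomial.eval_X, Polynomial.eval_ofNat]
    by_cases h : F O (σ k) = Data.nil
    · obtain ⟨t', τ', hr', ht', hv', hl'⟩ := (hp' O hO).1 k τ
      rw [hlow k le_rfl] at ht' hv'
      refine ⟨_, _, Run.seq (Run.copy _ _ _) (Run.seq hr (Run.condFalse (hv.trans h) hr')), ?_,
        by simp [h, hv'], fun i hi => by rw [hl' i hi, hlow i hi.le]⟩
      omega
    · obtain ⟨t', τ', hr', ht', hv', hl'⟩ := (hp'' O hO).1 k τ
      rw [hlow k le_rfl] at ht' hv'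
      refine ⟨_, _, Run.seq (Run.copy _ _ _) (Run.seq hr (Run.condTrue (by rwa [hv]) hr')), ?_,
        by simp [h, hv'], fun i hi => by rw [hl' i hi, hlow i hi.le]⟩
      omega
  · have := (hp' O hO).2 d
    have := (hp'' O hO).2 d
    simp only [Polynomial.eval_add, Polynomial.eval_X, Polynomial.eval_ofNat]
    split <;> omega

end PolyTime

/-- Primitive recursion along the right spine of a tree (that is, along a list), with the parameter
`u`. The step function gets the parameter, the current list and the value at its tail. -/
def Data.fold (g h : Data → Data) : Data → Data → Data
  | Data.nil, u => g u
  | Data.cons e l, u => h (Data.cons u (Data.cons (Data.cons e l) (Data.fold g h l u)))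

/-- Push all nonempty suffixes of the list `w` onto the stack `s`, the shortest one last. -/
def Data.pushSuffixes : Data → Data → Data
  | Data.nil, s => s
  | Data.cons e l, s => Data.pushSuffixes l (Data.cons (Data.cons e l) s)

/-- The loop that computes `Data.pushSuffixes`, for the list in variable `k + 1` and the stack in
variable `k + 2`. -/
def pushLoop (k : ℕ) : Cmd :=
  Cmd.loop (k + 1) (Cmd.seq (Cmd.cons (k + 2) (k + 1) (k + 2)) (Cmd.tail (k + 1) (k + 1)))

theorem run_pushLoop (O : Data → Data) (k N B : ℕ) (w s : Data) (σ : Store)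
    (hw : σ (k + 1) = w) (hs : σ (k + 2) = s) (hN : w.size ≤ N)
    (hB : s.size + w.size * (N + 1) ≤ B) :
    ∃ t τ, Run O (pushLoop k) σ t τ ∧ t ≤ 1 + w.size * (B + N + 3) ∧
      τ (k + 2) = w.pushSuffixes s ∧ ∀ i ≤ k, τ i = σ i := by
  induction w generalizing s σ with
  | nil => exact ⟨_, _, Run.loopEnd hw, by omega, hs, fun _ _ => rfl⟩
  | cons e l _ ih =>
    simp only [Data.size] at hN hB
    set σ₁ : Store := Function.update σ (k + 2) (Data.cons (Data.cons e l) s) with hσ₁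
    have h1 : σ₁ (k + 1) = Data.cons e l := by simp [hσ₁, hw]
    have hr1 : Run O (Cmd.cons (k + 2) (k + 1) (k + 2)) σ
        (1 + (Data.cons (Data.cons e l) s).size) σ₁ := by
      have := Run.cons (O := O) (k + 2) (k + 1) (k + 2) σ
      rwa [hw, hs] at this
    have hr2 := Run.tail (O := O) (k + 1) (k + 1) σ₁
    rw [h1] at hr2
    have hle : s.size + (e.size + l.size + 1 + 1) + l.size * (N + 1) ≤ B := by
      have : (e.size + l.size + 1) * (N + 1) = e.size * (N + 1) + l.size * (N + 1) + (N + 1) := by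
        ring
      omega
    obtain ⟨t, τ, hr, ht, hv, hl⟩ := ih (Data.cons (Data.cons e l) s)
      (Function.update σ₁ (k + 1) (Data.cons e l).snd) (by simp [Data.snd])
      (by rw [Function.update_of_ne (by omega)]; simp [hσ₁]) (by omega)
      (by simp only [Data.size]; omega)
    refine ⟨_, _, Run.loopStep (by simp [hw]) (Run.seq hr1 hr2) hr, ?_, hv, fun i hi => ?_⟩
    · simp only [Data.size, Data.snd]
      have : (e.size + l.size + 1) * (B + N + 3)
        = e.size * (B + N + 3) + l.size * (B + N + 3) + (B + N + 3) := by ring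
      have := e.one_le_size
      have : 1 * (B + N + 3) ≤ e.size * (B + N + 3) := by gcongr
      omega
    · rw [hl i hi, Function.update_of_ne (by omega), hσ₁, Function.update_of_ne (by omega)]

/-- The loop that computes `Data.fold` from the stack of suffixes in variable `k + 2`, with the
parameter in variable `k` and the accumulator in `k + 3`. -/
def foldLoop (c : ℕ → Cmd) (k : ℕ) : Cmd :=
  Cmd.loop (k + 2) (Cmd.seq (Cmd.head (k + 4) (k + 2)) (Cmd.seq (Cmd.tail (k + 2) (k + 2))
    (Cmd.seq (Cmd.cons (k + 4) (k + 4) (k + 3)) (Cmd.seq (Cmd.cons (k + 4) k (k + 4))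
      (Cmd.seq (c (k + 4)) (Cmd.copy (k + 3) (k + 4)))))))

/-- Popping all suffixes of `w` from the stack turns the value of the fold at the empty list into
its value at `w`. The rest of the run, on the stack `s`, is a hypothesis. -/
theorem run_foldLoop (O : Data → Data) (c : ℕ → Cmd) (k N B A T T' : ℕ) (g h : Data → Data)
    (u v w s : Data) (hN : w.size ≤ N) (hB : (w.pushSuffixes s).size ≤ B)
    (hA : ∀ l : Data, l.size ≤ N → (l.fold g h u).size ≤ A)
    (hc : ∀ j τ, (τ j).size ≤ u.size + N + A + 2 → Computes O (c j) j τ (h (τ j)) T)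
    (hend : ∀ σ : Store, σ k = u → σ (k + 2) = s → σ (k + 3) = w.fold g h u →
      ∃ t τ, Run O (foldLoop c k) σ t τ ∧ t ≤ T' ∧ τ (k + 3) = v ∧ ∀ i ≤ k, τ i = σ i)
    (σ : Store) (hu : σ k = u) (hs : σ (k + 2) = w.pushSuffixes s) (ha : σ (k + 3) = g u) :
    ∃ t τ, Run O (foldLoop c k) σ t τ ∧
      t ≤ T' + w.size * (T + B + u.size + 3 * N + 3 * A + 20) ∧
      τ (k + 3) = v ∧ ∀ i ≤ k, τ i = σ i := by
  induction w generalizing s σ T' with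
  | nil =>
    obtain ⟨t, τ, hr, ht, h'⟩ := hend σ hu hs ha
    exact ⟨t, τ, hr, by omega, h'⟩
  | cons e l _ ih =>
    have hsz : (Data.cons e l).size = e.size + l.size + 1 := rfl
    rw [hsz] at hN
    have hstack : ∀ x y : Data, y.size ≤ (x.pushSuffixes y).size := by
      intro x
      induction x with
      | nil => intro y; exact le_rfl
      | cons a b _ ihb =>
        intro y
        have := ihb (Data.cons (Data.cons a b) y)
        simp only [Data.size, Data.pushSuffixes] at this ⊢
        omega
    have hstep : ∀ σ : Store, σ k = u → σ (k + 2) = Data.cons (Data.cons e l) s →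
        σ (k + 3) = l.fold g h u → ∃ t τ, Run O (foldLoop c k) σ t τ ∧
          t ≤ T' + (T + B + u.size + 3 * N + 3 * A + 20) ∧ τ (k + 3) = v ∧ ∀ i ≤ k, τ i = σ i := by
      intro σ hu hs ha
      have hBs := (hstack l (Data.cons (Data.cons e l) s)).trans hB
      simp only [Data.size] at hBs
      have hAl := hA l (by omega)
      have hAw := hA (Data.cons e l) (by rw [hsz]; omega)
      set arg := Data.cons u (Data.cons (Data.cons e l) (l.fold g h u)) with harg
      have hr1 := Run.head (O := O) (k + 4) (k + 2) σ
      rw [hs, show (Data.cons (Data.cons e l) s).fst = Data.cons e l from rfl] at hr1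
      set σ₁ := Function.update σ (k + 4) (Data.cons e l) with hσ₁
      have hr2 := Run.tail (O := O) (k + 2) (k + 2) σ₁
      rw [show σ₁ (k + 2) = Data.cons (Data.cons e l) s by simp [hσ₁, hs],
        show (Data.cons (Data.cons e l) s).snd = s from rfl] at hr2
      set σ₂ := Function.update σ₁ (k + 2) s with hσ₂
      have hr3 := Run.cons (O := O) (k + 4) (k + 4) (k + 3) σ₂
      rw [show σ₂ (k + 4) = Data.cons e l by simp [hσ₂, hσ₁],
        show σ₂ (k + 3) = l.fold g h u by simp [hσ₂, hσ₁, ha]] at hr3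
      set σ₃ := Function.update σ₂ (k + 4) (Data.cons (Data.cons e l) (l.fold g h u)) with hσ₃
      have hr4 := Run.cons (O := O) (k + 4) k (k + 4) σ₃
      rw [show σ₃ k = u by simp [hσ₃, hσ₂, hσ₁, hu],
        show σ₃ (k + 4) = Data.cons (Data.cons e l) (l.fold g h u) by simp [hσ₃], ← harg] at hr4
      set σ₄ := Function.update σ₃ (k + 4) arg with hσ₄
      have h4 : σ₄ (k + 4) = arg := by simp [hσ₄]
      obtain ⟨t5, σ₅, hr5, ht5, hv5, hl5⟩ := hc (k + 4) σ₄ (by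
        rw [h4, harg]; simp only [Data.size]; omega)
      rw [h4] at hv5
      have hr6 := Run.copy (O := O) (k + 3) (k + 4) σ₅
      set σ₆ := Function.update σ₅ (k + 3) (σ₅ (k + 4)) with hσ₆
      have low : ∀ i ≤ k, σ₆ i = σ i := fun i hi => by
        rw [hσ₆, Function.update_of_ne (by omega), hl5 i (by omega), hσ₄,
          Function.update_of_ne (by omega), hσ₃, Function.update_of_ne (by omega), hσ₂,
          Function.update_of_ne (by omega), hσ₁, Function.update_of_ne (by omega)]
      obtain ⟨t, τ, hr, ht, hv, hl⟩ := hend σ₆ ((low k le_rfl).trans hu)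
        (by rw [hσ₆, Function.update_of_ne (by omega), hl5 _ (by omega)]
            simp [hσ₄, hσ₃, hσ₂])
        (by simp only [hσ₆, Function.update_self, hv5]; rfl)
      refine ⟨_, _, Run.loopStep (by simp [hs]) (Run.seq hr1 (Run.seq hr2 (Run.seq hr3
        (Run.seq hr4 (Run.seq hr5 hr6))))) hr, ?_, hv, fun i hi => by rw [hl i hi, low i hi]⟩
      rw [hv5, show h arg = (Data.cons e l).fold g h u from rfl]
      simp only [harg, Data.size] at *
      omega
    set C := T + B + u.size + 3 * N + 3 * A + 20 with hC
    obtain ⟨t, τ, hr, ht, h'⟩ := ih (T' + C) (Data.cons (Data.cons e l) s) (by omega) hB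
      hstep σ hu hs ha
    refine ⟨t, τ, hr, ?_, h'⟩
    rw [hsz, show (e.size + l.size + 1) * C = e.size * C + l.size * C + C by ring]
    omega

theorem Data.size_pushSuffixes_le (w s : Data) (N : ℕ) (hN : w.size ≤ N) :
    (w.pushSuffixes s).size ≤ s.size + w.size * (N + 1) := by
  induction w generalizing s with
  | nil => simp [Data.pushSuffixes]
  | cons e l _ ih =>
    simp only [Data.size] at hN
    have := ih (Data.cons (Data.cons e l) s) (by omega)
    simp only [Data.size, Data.pushSuffixes] at this ⊢
    have : (e.size + l.size + 1) * (N + 1) = e.size * (N + 1) + l.size * (N + 1) + (N + 1) := by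
      ring
    omega

theorem Data.size_fold_le {g h : Data → Data} {u : Data} {p : Polynomial ℕ}
    (hp : ∀ e l v, (h (Data.cons u (Data.cons (Data.cons e l) v))).size ≤
      v.size + p.eval (u.size + (Data.cons e l).size)) (w : Data) (N : ℕ) (hN : w.size ≤ N) :
    (w.fold g h u).size ≤ (g u).size + w.size * p.eval (u.size + N) := by
  induction w with
  | nil => simp [Data.fold]
  | cons e l _ ih =>
    have h1 := hp e l (l.fold g h u)
    have h2 := eval_mono_nat p (show u.size + (Data.cons e l).size ≤ u.size + N by omega)
    have h3 : l.size + 1 ≤ (Data.cons e l).size := by simp only [Data.size]; omega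
    have h4 := ih (by omega)
    have h5 : (l.size + 1) * p.eval (u.size + N) ≤
      (Data.cons e l).size * p.eval (u.size + N) := by gcongr
    rw [add_mul] at h5
    simp only [Data.fold]
    omega

/-- A step adds only polynomially many nodes to the accumulator. This keeps the value of a fold
polynomial, since the parameter and the list do not grow. -/
def AddsPoly (H : (Data → Data) → Data → Data) : Prop :=
  ∀ q : Polynomial ℕ, ∃ p : Polynomial ℕ, ∀ O, PolyAnswers q O → ∀ u e l v,
    (H O (Data.cons u (Data.cons (Data.cons e l) v))).size ≤
      v.size + p.eval (u.size + (Data.cons e l).size)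

namespace PolyTime

variable {G H U W : (Data → Data) → Data → Data}

theorem fold (hG : PolyTime G) (hH : PolyTime H) (hb : AddsPoly H) (hU : PolyTime U)
    (hW : PolyTime W) : PolyTime fun O d => (W O d).fold (G O) (H O) (U O d) := by
  refine comp (G := fun O d => d.snd.fold (G O) (H O) d.fst) (F := fun O d =>
    Data.cons (U O d) (W O d)) ?_ (cons hU hW)
  obtain ⟨c, hc⟩ := hG
  obtain ⟨c', hc'⟩ := hH
  refine ⟨fun k => Cmd.seq (Cmd.tail (k + 1) k) (Cmd.seq (Cmd.head k k) (Cmd.seq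
    (Cmd.setNil (k + 2)) (Cmd.seq (pushLoop k) (Cmd.seq (Cmd.copy (k + 3) k) (Cmd.seq
    (c (k + 3)) (Cmd.seq (foldLoop c' k) (Cmd.copy k (k + 3)))))))), fun q => ?_⟩
  obtain ⟨p, hp⟩ := hc q
  obtain ⟨p', hp'⟩ := hc' q
  obtain ⟨r, hr⟩ := hb q
  -- with `n` the size of the input: `A n` bounds the accumulator, `B n` the stack
  let A : Polynomial ℕ := p + Polynomial.X * r.comp (2 * Polynomial.X)
  let B : Polynomial ℕ := 1 + Polynomial.X * (Polynomial.X + 1)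
  let T : Polynomial ℕ := p'.comp (2 * Polynomial.X + A + 2)
  let X : Polynomial ℕ := Polynomial.X
  refine ⟨X * (B + X + 3) + X * (T + B + X + 3 * X + 3 * A + 20) + p + 3 * X + A + 20,
    fun O hO => ?_⟩
  have hA : ∀ n (u w : Data), u.size ≤ n → w.size ≤ n →
      (w.fold (G O) (H O) u).size ≤ A.eval n := by
    intro n u w hu hw
    have h1 := Data.size_fold_le (g := G O) (fun e l v => hr O hO u e l v) w n hw
    have h2 := ((hp O hO).2 u).trans (eval_mono_nat p hu)
    have h3 : w.size * r.eval (u.size + n) ≤ n * r.eval (2 * n) := by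
      gcongr; exact eval_mono_nat r (by omega)
    simp only [A, Polynomial.eval_add, Polynomial.eval_mul, Polynomial.eval_X,
      Polynomial.eval_comp, Polynomial.eval_ofNat]
    omega
  refine ⟨fun k σ => ?_, fun d => ?_⟩
  · set d := σ k with hd
    set n := d.size with hn
    have hu : d.fst.size ≤ n := d.size_fst_le
    have hw : d.snd.size ≤ n := d.size_snd_le
    have hr1 := Run.tail (O := O) (k + 1) k σ
    set σ₁ := Function.update σ (k + 1) (σ k).snd with hσ₁
    have hr2 := Run.head (O := O) k k σ₁
    rw [show σ₁ k = d by simp [hσ₁, hd]] at hr2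
    set σ₂ := Function.update σ₁ k d.fst with hσ₂
    have hr3 := Run.setNil (O := O) (k + 2) σ₂
    set σ₃ := Function.update σ₂ (k + 2) Data.nil with hσ₃
    have hmul : d.snd.size * (n + 1) ≤ n * (n + 1) := by gcongr
    have hBn : B.eval n = 1 + n * (n + 1) := by simp [B]
    obtain ⟨t4, σ₄, hr4, ht4, hv4, hl4⟩ := run_pushLoop O k n (B.eval n) d.snd Data.nil σ₃
      (by simp [hσ₃, hσ₂, hσ₁, hd]) (by simp [hσ₃]) hw (by simp only [Data.size]; omega)
    have h4k : σ₄ k = d.fst := by rw [hl4 k le_rfl]; simp [hσ₃, hσ₂]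
    have hr5 := Run.copy (O := O) (k + 3) k σ₄
    rw [h4k] at hr5
    set σ₅ := Function.update σ₄ (k + 3) d.fst with hσ₅
    obtain ⟨t6, σ₆, hr6, ht6, hv6, hl6⟩ := (hp O hO).1 (k + 3) σ₅
    rw [show σ₅ (k + 3) = d.fst by simp [hσ₅]] at ht6 hv6
    have h6 : ∀ i ≤ k, σ₆ i = σ₄ i := fun i hi => by
      rw [hl6 i (by omega), hσ₅, Function.update_of_ne (by omega)]
    obtain ⟨t7, σ₇, hr7, ht7, hv7, hl7⟩ := run_foldLoop O c' k n (B.eval n) (A.eval n)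
      (T.eval n) 1 (G O) (H O) d.fst (d.snd.fold (G O) (H O) d.fst) d.snd Data.nil hw
      (by have := Data.size_pushSuffixes_le d.snd Data.nil n hw
          simp only [Data.size] at this; omega)
      (fun l hl => hA n _ _ hu hl)
      (fun j τ hj => by
        obtain ⟨t, τ', h1, h2, h3⟩ := (hp' O hO).1 j τ
        refine ⟨t, τ', h1, h2.trans ?_, h3⟩
        simp only [T, Polynomial.eval_comp]
        refine eval_mono_nat p' (hj.trans ?_)
        simp only [Polynomial.eval_add, Polynomial.eval_mul, Polynomial.eval_X,
          Polynomial.eval_ofNat]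
        omega)
      (fun σ h1 h2 h3 => ⟨_, _, Run.loopEnd h2, le_rfl, h3, fun _ _ => rfl⟩)
      σ₆ ((h6 k le_rfl).trans h4k)
      (by rw [hl6 _ (by omega), hσ₅, Function.update_of_ne (by omega), hv4]) hv6
    have hr8 := Run.copy (O := O) k (k + 3) σ₇
    refine ⟨_, _, Run.seq hr1 (Run.seq hr2 (Run.seq hr3 (Run.seq hr4 (Run.seq hr5 (Run.seq hr6
      (Run.seq hr7 hr8)))))), ?_, by simp [hv7], fun i hi => ?_⟩
    · have e1 : d.snd.size * (B.eval n + n + 3) ≤ n * (B.eval n + n + 3) := by gcongr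
      have e2 : d.snd.size * (T.eval n + B.eval n + d.fst.size + 3 * n + 3 * A.eval n + 20) ≤
        n * (T.eval n + B.eval n + n + 3 * n + 3 * A.eval n + 20) := by gcongr
      have e3 := hA n d.fst d.snd hu hw
      have e4 := eval_mono_nat p hu
      rw [hv7, ← hd]
      simp only [Data.size, X, Polynomial.eval_add, Polynomial.eval_mul, Polynomial.eval_X,
        Polynomial.eval_ofNat]
      omega
    · rw [Function.update_of_ne (by omega), hl7 i (by omega), h6 i (by omega), hl4 i (by omega),
        hσ₃, Function.update_of_ne (by omega), hσ₂, Function.update_of_ne (by omega), hσ₁,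
        Function.update_of_ne (by omega)]
  · have := hA d.size d.fst d.snd d.size_fst_le d.size_snd_le
    simp only [X, Polynomial.eval_add] at this ⊢
    omega

end PolyTime

/-- A polynomial time function that maps every instance of `A` to a name of its answer, for every
oracle that solves `B`, is a reduction of `A` to `B`. -/
theorem PolyTime.reducible {F : (Data → Data) → Data → Data} (hF : PolyTime F) {θ : List ℝ}
    {A B : Problem} (h : ∀ q O, Solves θ q O B → ∀ d r, A d r → IsName θ (F O d) r) :
    PolyTimeTuringReducible θ A B := by
  obtain ⟨c, hc⟩ := hF
  refine ⟨c 0, fun q => ?_⟩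
  obtain ⟨p, hp⟩ := hc q
  refine ⟨p, fun O hO d r hA => ?_⟩
  obtain ⟨t, τ, hr, ht, hv, -⟩ := (hp O hO.1).1 0 (start d)
  exact ⟨t, τ, hr, ht, by rw [hv]; exact h q O hO d r hA⟩

/-! ### Sums over edge assignments -/

/-- The sum of `g` over all assignments that agree with `σ` outside the list `E` of edges. -/
noncomputable def sumE : List Data → ((Data → Bool) → ℝ) → (Data → Bool) → ℝ
  | [], g, σ => g σ
  | e :: E, g, σ => sumE E g (Function.update σ e false) + sumE E g (Function.update σ e true)

theorem sumE_append (E F : List Data) (g : (Data → Bool) → ℝ) (σ : Data → Bool) :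
    sumE (E ++ F) g σ = sumE E (sumE F g) σ := by
  induction E generalizing σ with
  | nil => rfl
  | cons e E ih => simp [sumE, ih]

theorem sumE_congr {E : List Data} {g g' : (Data → Bool) → ℝ} {σ : Data → Bool}
    (h : ∀ τ : Data → Bool, (∀ e ∉ E, τ e = σ e) → g τ = g' τ) : sumE E g σ = sumE E g' σ := by
  induction E generalizing σ with
  | nil => exact h σ fun _ _ => rfl
  | cons e E ih =>
    have key : ∀ b, sumE E g (Function.update σ e b) = sumE E g' (Function.update σ e b) :=
      fun b => ih fun τ hτ => h τ fun i hi => by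
        rw [List.mem_cons, not_or] at hi
        rw [hτ i hi.2, Function.update_of_ne hi.1]
    simp only [sumE, key]

theorem sumE_const_mul (E : List Data) (c : ℝ) (g : (Data → Bool) → ℝ) (σ : Data → Bool) :
    sumE E (fun τ => c * g τ) σ = c * sumE E g σ := by
  induction E generalizing σ with
  | nil => rfl
  | cons e E ih => simp only [sumE, ih]; ring

/-- A factor that does not depend on the edges of the sum can be taken out. -/
theorem sumE_mul_of_dependsOn {E : List Data} {A : (Data → Bool) → ℝ} {s : Set Data}
    (hA : DependsOn A s) (hs : ∀ e ∈ E, e ∉ s) (g : (Data → Bool) → ℝ) (σ : Data → Bool) :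
    sumE E (fun τ => A τ * g τ) σ = A σ * sumE E g σ := by
  rw [← sumE_const_mul]
  exact sumE_congr fun τ hτ => by
    rw [hA fun e he => hτ e fun h => hs e h he]

theorem dependsOn_sumE {E : List Data} {g : (Data → Bool) → ℝ} {s : Set Data}
    (hg : DependsOn g {e | e ∈ s ∨ e ∈ E}) : DependsOn (sumE E g) s := by
  induction E generalizing s with
  | nil => exact fun σ τ h => hg fun e he => h e (by simpa using he)
  | cons e E ih =>
    intro σ τ h
    have key : DependsOn (sumE E g) {i | i ∈ s ∨ i = e} :=
      ih fun σ τ h => hg fun i hi => h i (by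
        simp only [Set.mem_ofPred_eq, List.mem_cons] at hi ⊢
        tauto)
    have (b : Bool) : sumE E g (Function.update σ e b) = sumE E g (Function.update τ e b) :=
      key fun i hi => by
        by_cases hie : i = e
        · simp [hie]
        · rw [Function.update_of_ne hie, Function.update_of_ne hie]
          exact h i (hi.resolve_right hie)
    simp only [sumE, this]

theorem sumE_perm {E F : List Data} (h : E.Perm F) (hE : E.Nodup) (g : (Data → Bool) → ℝ)
    (σ : Data → Bool) : sumE E g σ = sumE F g σ := by
  revert hE σ
  induction h with
  | nil => exact fun _ _ => rfl
  | cons e _ ih =>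
    intro hn σ
    simp only [sumE, ih (List.nodup_cons.1 hn).2]
  | swap e f E =>
    intro hn σ
    have hne : f ≠ e := fun h => by simp [h] at hn
    simp only [sumE, Function.update_comm hne]
    ring
  | trans h _ ih ih' => exact fun hn σ => (ih hn σ).trans (ih' (h.nodup_iff.1 hn) σ)

/-- The sum over all sets `T` of edges, as in the definition of `holant`, is a sum over assignments.
The assignment `σ` is general for the sake of the induction. -/
theorem sum_powerset_eq_sumE {E : List Data} (hE : E.Nodup) (g : (Data → Bool) → ℝ)
    (σ : Data → Bool) (hσ : ∀ e ∈ E, σ e = false) :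
    ∑ T ∈ E.toFinset.powerset, g (fun e => σ e || decide (e ∈ T)) = sumE E g σ := by
  induction E generalizing σ with
  | nil => simp [sumE]
  | cons e E ih =>
    obtain ⟨he, hE⟩ := List.nodup_cons.1 hE
    have hne : ∀ i ∈ E, i ≠ e := fun i hi h => he (h ▸ hi)
    rw [List.toFinset_cons, Finset.sum_powerset_insert (by simpa using he), sumE,
      ← ih hE _ fun i hi => by
        rw [Function.update_of_ne (hne i hi)]; exact hσ i (List.mem_cons_of_mem _ hi),
      ← ih hE _ fun i hi => by
        rw [Function.update_of_ne (hne i hi)]; exact hσ i (List.mem_cons_of_mem _ hi)]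
    congr 1
    · refine Finset.sum_congr rfl fun T hT => congrArg g (funext fun i => ?_)
      by_cases hi : i = e
      · subst hi; simp [hσ]
      · simp [Function.update_of_ne hi]
    · refine Finset.sum_congr rfl fun T hT => congrArg g (funext fun i => ?_)
      by_cases hi : i = e
      · subst hi; simp
      · simp [hi]

/-- The product of the values of all vertices. -/
noncomputable def prodWeight (S : List Sig) (Ω : Grid) (σ : Data → Bool) : ℝ :=
  (Ω.map (Vertex.weight S σ)).prod

@[simp]
theorem prodWeight_nil (S : List Sig) (σ : Data → Bool) : prodWeight S [] σ = 1 := rfl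

@[simp]
theorem prodWeight_cons (S : List Sig) (v : Vertex) (Ω : Grid) (σ : Data → Bool) :
    prodWeight S (v :: Ω) σ = v.weight S σ * prodWeight S Ω σ := by
  simp [prodWeight]

@[simp]
theorem prodWeight_append (S : List Sig) (Ω Ω' : Grid) (σ : Data → Bool) :
    prodWeight S (Ω ++ Ω') σ = prodWeight S Ω σ * prodWeight S Ω' σ := by
  simp [prodWeight]

theorem prodWeight_flatMap (S : List Sig) (Ω : Grid) (f : Vertex → Grid) (σ : Data → Bool) :
    prodWeight S (Ω.flatMap f) σ = (Ω.map fun v => prodWeight S (f v) σ).prod := by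
  induction Ω with
  | nil => rfl
  | cons v Ω ih => rw [List.flatMap_cons, prodWeight_append, ih, List.map_cons, List.prod_cons]

@[simp]
theorem Grid.lEnds_cons (v : Vertex) (Ω : Grid) :
    Grid.lEnds (v :: Ω) = v.lEnds ++ Grid.lEnds Ω := rfl

@[simp]
theorem Grid.rEnds_cons (v : Vertex) (Ω : Grid) :
    Grid.rEnds (v :: Ω) = v.rEnds ++ Grid.rEnds Ω := rfl

@[simp]
theorem Grid.lEnds_nil : Grid.lEnds [] = [] := rfl

@[simp]
theorem Grid.rEnds_nil : Grid.rEnds [] = [] := rfl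

@[simp]
theorem Grid.lEnds_append (Ω Ω' : Grid) :
    Grid.lEnds (Ω ++ Ω') = Grid.lEnds Ω ++ Grid.lEnds Ω' := List.flatMap_append

@[simp]
theorem Grid.rEnds_append (Ω Ω' : Grid) :
    Grid.rEnds (Ω ++ Ω') = Grid.rEnds Ω ++ Grid.rEnds Ω' := List.flatMap_append

theorem holant_eq_sumE {S : List Sig} {Ω : Grid} {E : List Data} (hn : Ω.lEnds.Nodup)
    (hE : Ω.lEnds.Perm E) : holant S Ω = sumE E (prodWeight S Ω) fun _ => false := by
  rw [← sumE_perm hE hn, ← sum_powerset_eq_sumE hn _ _ fun _ _ => rfl]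
  simp [holant, prodWeight]

theorem Vertex.dependsOn_weight (S : List Sig) (v : Vertex) :
    DependsOn (fun σ => v.weight S σ) {e | e ∈ v.lEnds ∨ e ∈ v.rEnds} := by
  intro σ τ h
  have h1 : v.lEnds.map σ = v.lEnds.map τ := List.map_congr_left fun e he => h e (Or.inl he)
  have h2 : v.rEnds.map σ = v.rEnds.map τ := List.map_congr_left fun e he => h e (Or.inr he)
  simp only [Vertex.weight, h1, h2]

theorem dependsOn_prodWeight (S : List Sig) (Ω : Grid) :
    DependsOn (prodWeight S Ω) {e | e ∈ Ω.lEnds ∨ e ∈ Ω.rEnds} := by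
  intro σ τ h
  refine congrArg List.prod (List.map_congr_left fun v hv => ?_)
  exact v.dependsOn_weight S fun e he => h e (he.imp
    (fun he => List.mem_flatMap.2 ⟨v, hv, he⟩) fun he => List.mem_flatMap.2 ⟨v, hv, he⟩)

/-! ### Replacing vertices by gadgets -/

/-- The vertex `v` carries a signature from `S`, and has as many ends as it has variables. -/
def Vertex.Fits (S : List Sig) (v : Vertex) : Prop :=
  ∃ s, S[v.label]? = some s ∧ v.lEnds.length = s.l ∧ v.rEnds.length = s.r

/-- Distributivity: if every factor has its own list `I v` of edges besides the common edges in `s`,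
then the sum over all the own edges of the product is the product of the sums. -/
theorem sumE_flatMap {α : Type*} (L : List α) (I : α → List Data)
    (g : α → (Data → Bool) → ℝ) (s : Set Data)
    (hg : ∀ v ∈ L, DependsOn (g v) {e | e ∈ s ∨ e ∈ I v}) (hI : ∀ v ∈ L, ∀ e ∈ I v, e ∉ s)
    (hn : (L.flatMap I).Nodup) (σ : Data → Bool) :
    sumE (L.flatMap I) (fun τ => (L.map fun v => g v τ).prod) σ =
      (L.map fun v => sumE (I v) (g v) σ).prod := by
  induction L generalizing σ with
  | nil => simp [sumE]
  | cons v L ih =>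
    rw [List.flatMap_cons, List.nodup_append'] at hn
    obtain ⟨-, hn, hd⟩ := hn
    have hgL : ∀ u ∈ L, DependsOn (g u) {e | e ∈ s ∨ e ∈ I u} := fun u hu =>
      hg u (List.mem_cons_of_mem _ hu)
    have hIL : ∀ u ∈ L, ∀ e ∈ I u, e ∉ s := fun u hu => hI u (List.mem_cons_of_mem _ hu)
    have hR : DependsOn (fun σ => (L.map fun u => sumE (I u) (g u) σ).prod) s := by
      intro σ τ h
      exact congrArg List.prod (List.map_congr_left fun u hu => dependsOn_sumE (hgL u hu) h)
    simp only [List.flatMap_cons, List.map_cons, List.prod_cons, sumE_append]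
    rw [mul_comm, ← sumE_mul_of_dependsOn hR (hI v List.mem_cons_self)]
    refine sumE_congr fun τ _ => ?_
    rw [sumE_mul_of_dependsOn (hg v List.mem_cons_self) ?_, ih hgL hIL hn, mul_comm]
    rintro e he (h | h)
    · obtain ⟨u, hu, he⟩ := List.mem_flatMap.1 he
      exact hIL u hu e he h
    · exact hd h he

theorem Grid.lEnds_flatMap (Ω : Grid) (f : Vertex → Grid) :
    Grid.lEnds (Ω.flatMap f) = Ω.flatMap fun v => (f v).lEnds := List.flatMap_assoc

theorem Grid.rEnds_flatMap (Ω : Grid) (f : Vertex → Grid) :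
    Grid.rEnds (Ω.flatMap f) = Ω.flatMap fun v => (f v).rEnds := List.flatMap_assoc

theorem flatMap_append_perm {α β : Type*} (L : List α) (f g : α → List β) :
    (L.flatMap fun v => f v ++ g v).Perm (L.flatMap f ++ L.flatMap g) := by
  induction L with
  | nil => simp
  | cons v L ih =>
    simp only [List.flatMap_cons, List.append_assoc]
    refine List.Perm.append_left _ ?_
    refine (ih.append_left _).trans ?_
    rw [← List.append_assoc, ← List.append_assoc]
    exact List.perm_append_comm.append_right _

theorem flatMap_perm_of_perm {α β : Type*} {L : List α} {f g : α → List β}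
    (h : ∀ v ∈ L, (f v).Perm (g v)) : (L.flatMap f).Perm (L.flatMap g) := by
  induction L with
  | nil => simp
  | cons v L ih =>
    simp only [List.flatMap_cons]
    exact (h v List.mem_cons_self).append (ih fun u hu => h u (List.mem_cons_of_mem _ hu))

/-- Replacing every vertex `v` by a gadget `ex v` with the same dangling edges and with internal
edges `I v` does not change the Holant value, provided that the signature of the gadget is that of
the vertex. -/
theorem holant_flatMap {S S' : List Sig} {Ω : Grid} (hΩ : Ω.WellFormed S) (ex : Vertex → Grid)
    (I : Vertex → List Data) (hfit : ∀ v ∈ Ω, ∀ u ∈ ex v, u.Fits S')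
    (hl : ∀ v ∈ Ω, (ex v).lEnds.Perm (v.lEnds ++ I v))
    (hr : ∀ v ∈ Ω, (ex v).rEnds.Perm (v.rEnds ++ I v))
    (hn : (Ω.flatMap I).Nodup) (hd : ∀ v ∈ Ω, ∀ e ∈ I v, e ∉ Ω.lEnds)
    (hw : ∀ v ∈ Ω, ∀ σ, sumE (I v) (prodWeight S' (ex v)) σ = v.weight S σ) :
    Grid.WellFormed S' (Ω.flatMap ex) ∧ holant S' (Ω.flatMap ex) = holant S Ω := by
  obtain ⟨-, hnl, hlr⟩ := hΩ
  have hL : (Grid.lEnds (Ω.flatMap ex)).Perm (Ω.lEnds ++ Ω.flatMap I) := by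
    rw [Grid.lEnds_flatMap]
    exact (flatMap_perm_of_perm hl).trans (flatMap_append_perm Ω _ _)
  have hR : (Grid.rEnds (Ω.flatMap ex)).Perm (Ω.rEnds ++ Ω.flatMap I) := by
    rw [Grid.rEnds_flatMap]
    exact (flatMap_perm_of_perm hr).trans (flatMap_append_perm Ω _ _)
  have hnod : (Ω.lEnds ++ Ω.flatMap I).Nodup := by
    refine List.nodup_append'.2 ⟨hnl, hn, fun e he he' => ?_⟩
    obtain ⟨v, hv, h⟩ := List.mem_flatMap.1 he'
    exact hd v hv e h he
  refine ⟨⟨fun u hu => ?_, hL.nodup_iff.2 hnod, hL.trans ((hlr.append_right _).trans hR.symm)⟩, ?_⟩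
  · obtain ⟨v, hv, hu⟩ := List.mem_flatMap.1 hu
    exact hfit v hv u hu
  · rw [holant_eq_sumE (hL.nodup_iff.2 hnod) hL, holant_eq_sumE hnl (List.Perm.refl _),
      sumE_append]
    refine sumE_congr fun τ _ => ?_
    rw [show prodWeight S' (Ω.flatMap ex) = _ from funext fun τ => prodWeight_flatMap S' Ω ex τ,
      sumE_flatMap Ω I _ {e | e ∈ Ω.lEnds} ?_ hd hn τ]
    · exact congrArg List.prod (List.map_congr_left fun v hv => hw v hv τ)
    · intro v hv σ τ h
      refine dependsOn_prodWeight S' (ex v) fun e he => h e ?_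
      rcases he with he | he
      · exact (List.mem_append.1 ((hl v hv).mem_iff.1 he)).imp
          (fun he => List.mem_flatMap.2 ⟨v, hv, he⟩) fun he => he
      · exact (List.mem_append.1 ((hr v hv).mem_iff.1 he)).imp
          (fun he => hlr.mem_iff.2 (List.mem_flatMap.2 ⟨v, hv, he⟩)) fun he => he

/-! ### Chains of gadgets -/

theorem Data.ofNat_injective : Function.Injective Data.ofNat := by
  intro m
  induction m with
  | zero => intro n h; cases n <;> simp_all [Data.ofNat]
  | succ m ih =>
    intro n h
    cases n with
    | zero => simp [Data.ofNat] at h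
    | succ n => simp only [Data.ofNat, Data.cons.injEq, true_and] at h; rw [ih h]

/-- A vertex with the first signature, ternary on the LHS. -/
def lVertex (e₁ e₂ e₃ : Data) : Vertex := ⟨0, [e₁, e₂, e₃], []⟩

/-- A vertex with the second signature, ternary on the RHS. -/
def rVertex (e₁ e₂ e₃ : Data) : Vertex := ⟨1, [], [e₁, e₂, e₃]⟩

section Link

variable {f g : Sig} {p q r s t : Data}

theorem sumE_link (hps : p ≠ s) (hpt : p ≠ t) (hqs : q ≠ s) (hqt : q ≠ t) (hst : s ≠ t)
    (σ : Data → Bool) :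
    sumE [s, t] (prodWeight [f, g] [lVertex p s t, rVertex s t q]) σ =
      gadgetG1 f g (bit (σ p)) (bit (σ q)) := by
  have hb : ∀ u : Bool, decide (bit u = 1) = u := by decide
  simp only [sumE, prodWeight_cons, prodWeight_nil, Vertex.weight, lVertex, rVertex, gadgetG1,
    List.getElem?_cons_zero, List.getElem?_cons_succ, List.map_cons, List.map_nil,
    Matrix.of_apply, Fintype.sum_bool, hb, Function.update_self, Function.update_of_ne hps,
    Function.update_of_ne hpt, Function.update_of_ne hqs, Function.update_of_ne hqt,
    Function.update_of_ne hst]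
  ring

/-- Attaching one more copy of the binary gadget, by the edge `r`, to a gadget `Γ` with dangling
edges `r`, `q` and internal edges `J` multiplies the signature matrix. -/
theorem sumE_link_cons {Γ : Grid} {J : List Data} {K : Matrix (Fin 2) (Fin 2) ℝ}
    (hK : ∀ τ, sumE J (prodWeight [f, g] Γ) τ = K (bit (τ r)) (bit (τ q)))
    (hJ : ∀ e ∈ J, e ≠ p ∧ e ≠ s ∧ e ≠ t ∧ e ≠ r) (hpr : p ≠ r) (hqr : q ≠ r) (hrs : r ≠ s)
    (hrt : r ≠ t) (hps : p ≠ s) (hpt : p ≠ t) (hqs : q ≠ s) (hqt : q ≠ t) (hst : s ≠ t)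
    (σ : Data → Bool) :
    sumE (r :: s :: t :: J) (prodWeight [f, g] (lVertex p s t :: rVertex s t r :: Γ)) σ =
      (gadgetG1 f g * K) (bit (σ p)) (bit (σ q)) := by
  have hA : prodWeight [f, g] (lVertex p s t :: rVertex s t r :: Γ) =
      fun τ => prodWeight [f, g] [lVertex p s t, rVertex s t r] τ * prodWeight [f, g] Γ τ := by
    funext τ
    simp [mul_assoc]
  have hin : ∀ τ, sumE ([s, t] ++ J) (prodWeight [f, g] (lVertex p s t :: rVertex s t r :: Γ)) τ =
      K (bit (τ r)) (bit (τ q)) * gadgetG1 f g (bit (τ p)) (bit (τ r)) := by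
    intro τ
    have hdep : DependsOn (fun τ : Data → Bool => K (bit (τ r)) (bit (τ q))) {r, q} :=
      fun σ τ h => by simp only [h r (by simp), h q (by simp)]
    rw [sumE_append, ← sumE_link hps hpt hrs hrt hst τ, ← sumE_mul_of_dependsOn hdep (by
      simp [hrs.symm, hrt.symm, hqs.symm, hqt.symm])]
    refine sumE_congr fun τ _ => ?_
    rw [hA, sumE_mul_of_dependsOn (dependsOn_prodWeight _ _) (fun e he => ?_), hK, mul_comm]
    obtain ⟨h1, h2, h3, h4⟩ := hJ e he
    simp [lVertex, rVertex, h1, h2, h3, h4]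
  change sumE ([s, t] ++ J) _ _ + sumE ([s, t] ++ J) _ _ = _
  rw [hin, hin, Matrix.mul_apply, Fin.sum_univ_two]
  simp only [Function.update_self, Function.update_of_ne hpr, Function.update_of_ne hqr, bit]
  simp only [Bool.false_eq_true, if_false, if_true]
  ring

end Link

/-- The length of the right spine of a tree, that is, the length of a list. -/
def Data.len : Data → ℕ
  | Data.nil => 0
  | Data.cons _ l => l.len + 1

/-- The name of an internal edge of a chain. If `d` is larger than all edges of a grid, then these
names are new; `q` tells apart the chains, `w` the links of a chain, and `i` the edges of a link. -/
def edge (d q w : Data) (i : ℕ) : Data :=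
  Data.cons d (Data.cons w (Data.cons (Data.ofNat i) q))

@[simp]
theorem edge_inj {d q w q' w' : Data} {i i' : ℕ} :
    edge d q w i = edge d q' w' i' ↔ q = q' ∧ w = w' ∧ i = i' := by
  simp only [edge, Data.cons.injEq, true_and, Data.ofNat_injective.eq_iff]
  tauto

theorem size_lt_size_edge (d q w : Data) (i : ℕ) : d.size < (edge d q w i).size := by
  simp only [edge, Data.size]; omega

/-- A chain of `w.len + 1` binary gadgets with the dangling edges `edge d q w 2` and `q`. -/
def chain (d q : Data) : Data → Grid
  | Data.nil => [lVertex (edge d q .nil 2) (edge d q .nil 0) (edge d q .nil 1),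
      rVertex (edge d q .nil 0) (edge d q .nil 1) q]
  | Data.cons e l =>
    lVertex (edge d q (.cons e l) 2) (edge d q (.cons e l) 0) (edge d q (.cons e l) 1) ::
      rVertex (edge d q (.cons e l) 0) (edge d q (.cons e l) 1) (edge d q l 2) :: chain d q l

/-- The internal edges of `chain d q w`. -/
def chainEdges (d q : Data) : Data → List Data
  | Data.nil => [edge d q .nil 0, edge d q .nil 1]
  | Data.cons e l =>
    edge d q l 2 :: edge d q (.cons e l) 0 :: edge d q (.cons e l) 1 :: chainEdges d q l

theorem mem_chainEdges {d q w e : Data} (h : e ∈ chainEdges d q w) :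
    ∃ l i, e = edge d q l i ∧ (l.size < w.size ∨ l = w ∧ i < 2) := by
  induction w with
  | nil =>
    simp only [chainEdges, List.mem_cons, List.not_mem_nil, or_false] at h
    rcases h with h | h
    · exact ⟨_, _, h, Or.inr ⟨rfl, by omega⟩⟩
    · exact ⟨_, _, h, Or.inr ⟨rfl, by omega⟩⟩
  | cons a l _ ih =>
    have hlt : l.size < (Data.cons a l).size := by simp only [Data.size]; omega
    simp only [chainEdges, List.mem_cons] at h
    rcases h with h | h | h | h
    · exact ⟨_, _, h, Or.inl hlt⟩
    · exact ⟨_, _, h, Or.inr ⟨rfl, by omega⟩⟩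
    · exact ⟨_, _, h, Or.inr ⟨rfl, by omega⟩⟩
    · obtain ⟨l', i, h, h'⟩ := ih h
      refine ⟨l', i, h, Or.inl ?_⟩
      rcases h' with h' | ⟨rfl, -⟩ <;> omega

theorem nodup_chainEdges (d q w : Data) : (chainEdges d q w).Nodup := by
  induction w with
  | nil => simp [chainEdges]
  | cons a l _ ih =>
    have hlt : l.size < (Data.cons a l).size := by simp only [Data.size]; omega
    have hne : l ≠ Data.cons a l := fun h => by rw [← h] at hlt; exact lt_irrefl _ hlt
    have h1 : ∀ i, edge d q (.cons a l) i ∉ chainEdges d q l := fun i h => by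
      obtain ⟨l', i', h, h'⟩ := mem_chainEdges h
      rw [edge_inj] at h
      rcases h' with h' | h'
      · rw [← h.2.1] at h'; omega
      · exact hne (h'.1.symm.trans h.2.1.symm)
    have h2 : edge d q l 2 ∉ chainEdges d q l := fun h => by
      obtain ⟨l', i', h, h'⟩ := mem_chainEdges h
      rw [edge_inj] at h
      rcases h' with h' | h'
      · rw [← h.2.1] at h'; omega
      · omega
    simp [chainEdges, h1, h2, ih, hne]

theorem lEnds_chain_perm (d q w : Data) :
    (chain d q w).lEnds.Perm (edge d q w 2 :: chainEdges d q w) := by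
  induction w with
  | nil => simp [chain, chainEdges, lVertex, rVertex]
  | cons a l _ ih =>
    refine List.perm_iff_count.2 fun e => ?_
    have := ih.count_eq e
    simp only [chain, chainEdges, lVertex, rVertex, Grid.lEnds_cons, List.count_cons,
      List.count_append, List.nil_append, List.count_nil] at this ⊢
    omega

theorem rEnds_chain_perm (d q w : Data) : (chain d q w).rEnds.Perm (q :: chainEdges d q w) := by
  induction w with
  | nil =>
    refine List.perm_iff_count.2 fun e => ?_
    simp only [chain, chainEdges, lVertex, rVertex, Grid.rEnds_cons, List.count_cons,
      List.count_append, List.nil_append, List.count_nil, Grid.rEnds_nil]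
    omega
  | cons a l _ ih =>
    refine List.perm_iff_count.2 fun e => ?_
    have := ih.count_eq e
    simp only [chain, chainEdges, lVertex, rVertex, Grid.rEnds_cons, List.count_cons,
      List.count_append, List.nil_append, List.count_nil] at this ⊢
    omega

theorem fits_of_mem_chain {f g : Sig} (hf : f.l = 3 ∧ f.r = 0) (hg : g.l = 0 ∧ g.r = 3)
    {d q w : Data} {v : Vertex} (hv : v ∈ chain d q w) : v.Fits [f, g] := by
  induction w with
  | nil =>
    simp only [chain, List.mem_cons, List.not_mem_nil, or_false] at hv
    rcases hv with rfl | rfl <;> simp [Vertex.Fits, lVertex, rVertex, hf, hg]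
  | cons a l _ ih =>
    simp only [chain, List.mem_cons] at hv
    rcases hv with rfl | rfl | hv
    · simp [Vertex.Fits, lVertex, hf]
    · simp [Vertex.Fits, rVertex, hg]
    · exact ih hv

theorem ne_edge_of_size_lt {d p : Data} (hp : p.size < d.size) (q w : Data) (i : ℕ) :
    p ≠ edge d q w i := fun h => by
  have := size_lt_size_edge d q w i
  rw [← h] at this
  omega

/-- A chain of `w.len + 1` binary gadgets has the signature matrix `G₁ ^ (w.len + 1)`. -/
theorem sumE_chain (f g : Sig) {d q : Data} (hq : q.size < d.size) (w : Data) (σ : Data → Bool) :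
    sumE (chainEdges d q w) (prodWeight [f, g] (chain d q w)) σ =
      (gadgetG1 f g ^ (w.len + 1)) (bit (σ (edge d q w 2))) (bit (σ q)) := by
  have hqe := ne_edge_of_size_lt hq q
  induction w generalizing σ with
  | nil =>
    rw [Data.len, zero_add, pow_one]
    exact sumE_link (by simp) (by simp) (hqe _ _) (hqe _ _) (by simp) σ
  | cons a l _ ih =>
    have hlt : l.size < (Data.cons a l).size := by simp only [Data.size]; omega
    have hne : l ≠ Data.cons a l := fun h => by rw [← h] at hlt; exact lt_irrefl _ hlt
    have hnd := nodup_chainEdges d q (.cons a l)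
    simp only [chainEdges, List.nodup_cons, List.mem_cons, not_or] at hnd
    rw [Data.len, pow_succ']
    refine sumE_link_cons ih (fun e he => ?_) (by simp [hne.symm]) (hqe _ _) (by simp [hne])
      (by simp [hne]) (by simp) (by simp) (hqe _ _) (hqe _ _) (by simp) σ
    refine ⟨?_, fun h => hnd.2.1.2 (h ▸ he), fun h => hnd.2.2.1 (h ▸ he),
      fun h => hnd.1.2.2 (h ▸ he)⟩
    rintro rfl
    obtain ⟨l', i', h, h'⟩ := mem_chainEdges he
    rw [edge_inj] at h
    rcases h' with h' | h'
    · rw [← h.2.1] at h'; omega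
    · exact hne (h'.1.symm.trans h.2.1.symm)

/-- Replace a straddled vertex, recognized by its label, by a chain of `w.len + 2` copies of the
binary gadget. -/
def expand (d w : Data) (v : Vertex) : Grid :=
  if v.label < 2 then [v] else
    lVertex (v.lEnds.headD .nil) (edge d (v.rEnds.headD .nil) w 3)
        (edge d (v.rEnds.headD .nil) w 4) ::
      rVertex (edge d (v.rEnds.headD .nil) w 3) (edge d (v.rEnds.headD .nil) w 4)
        (edge d (v.rEnds.headD .nil) w 2) :: chain d (v.rEnds.headD .nil) w

/-- The internal edges of `expand d w v`. -/
def expandEdges (d w : Data) (v : Vertex) : List Data :=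
  if v.label < 2 then [] else
    edge d (v.rEnds.headD .nil) w 2 :: edge d (v.rEnds.headD .nil) w 3 ::
      edge d (v.rEnds.headD .nil) w 4 :: chainEdges d (v.rEnds.headD .nil) w

theorem mem_expandEdges {d w e : Data} {v : Vertex} (h : e ∈ expandEdges d w v) :
    2 ≤ v.label ∧ ∃ l i, e = edge d (v.rEnds.headD .nil) l i := by
  unfold expandEdges at h
  split at h
  · simp at h
  · refine ⟨by omega, ?_⟩
    simp only [List.mem_cons] at h
    rcases h with h | h | h | h
    · exact ⟨_, _, h⟩
    · exact ⟨_, _, h⟩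
    · exact ⟨_, _, h⟩
    · obtain ⟨l, i, h, -⟩ := mem_chainEdges h
      exact ⟨l, i, h⟩

theorem not_mem_chainEdges {d q w : Data} {i : ℕ} (hi : 2 ≤ i) :
    edge d q w i ∉ chainEdges d q w := fun h => by
  obtain ⟨l', i', h, h'⟩ := mem_chainEdges h
  rw [edge_inj] at h
  rcases h' with h' | h'
  · rw [← h.2.1] at h'; omega
  · omega

/-- With three signatures, a vertex carries one of the first two, or it has label `2` and carries
the third one. -/
theorem Vertex.Fits.cases {f g s : Sig} {v : Vertex} (h : v.Fits [f, g, s]) :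
    (v.label < 2 ∧ v.Fits [f, g]) ∨
      (v.label = 2 ∧ v.lEnds.length = s.l ∧ v.rEnds.length = s.r) := by
  obtain ⟨s', hs, h1, h2⟩ := h
  obtain ⟨n, l, r⟩ := v
  match n, hs with
  | 0, hs => exact Or.inl ⟨by simp, s', hs, h1, h2⟩
  | 1, hs => exact Or.inl ⟨by simp, s', hs, h1, h2⟩
  | 2, hs =>
    obtain rfl : s = s' := by simpa using hs
    exact Or.inr ⟨rfl, h1, h2⟩

/-- A straddled signature whose matrix is a power of that of the binary gadget can be replaced by
chains of gadgets. All names of internal edges are new if `d` is larger than the edges of `Ω`. -/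
theorem holant_expand {f g : Sig} (hf : f.l = 3 ∧ f.r = 0) (hg : g.l = 0 ∧ g.r = 3)
    {Ω : Grid} {M : Matrix (Fin 2) (Fin 2) ℝ} {d w : Data}
    (hM : M = gadgetG1 f g ^ (w.len + 2)) (hΩ : Ω.WellFormed [f, g, straddled M])
    (hd : ∀ e ∈ Ω.lEnds, e.size < d.size) :
    Grid.WellFormed [f, g] (Ω.flatMap (expand d w)) ∧
      holant [f, g] (Ω.flatMap (expand d w)) = holant [f, g, straddled M] Ω := by
  have hcase : ∀ v ∈ Ω, (v.label < 2 ∧ v.Fits [f, g]) ∨ ∃ p q, v = ⟨2, [p], [q]⟩ ∧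
      p.size < d.size ∧ q.size < d.size := fun v hv => by
    refine (Vertex.Fits.cases (hΩ.1 v hv)).imp_right fun ⟨h, h1, h2⟩ => ?_
    obtain ⟨p, hp⟩ := List.length_eq_one_iff.1 h1
    obtain ⟨q, hq⟩ := List.length_eq_one_iff.1 h2
    obtain ⟨n, l, r⟩ := v
    simp only at h hp hq
    subst h hp hq
    exact ⟨p, q, rfl, hd p (List.mem_flatMap.2 ⟨_, hv, by simp⟩),
      hd q (hΩ.2.2.mem_iff.2 (List.mem_flatMap.2 ⟨_, hv, by simp⟩))⟩
  refine holant_flatMap hΩ (expand d w) (expandEdges d w) ?_ ?_ ?_ ?_ ?_ ?_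
  · intro v hv u hu
    rcases hcase v hv with ⟨h, h'⟩ | ⟨p, q, rfl, -⟩
    · simp only [expand, h, if_true, List.mem_singleton] at hu
      rwa [hu]
    · simp only [expand, lt_irrefl, if_false, List.mem_cons] at hu
      rcases hu with rfl | rfl | hu
      · simp [Vertex.Fits, lVertex, hf]
      · simp [Vertex.Fits, rVertex, hg]
      · exact fits_of_mem_chain hf hg hu
  · intro v hv
    rcases hcase v hv with ⟨h, h'⟩ | ⟨p, q, rfl, -⟩
    · simp [expand, expandEdges, h]
    · refine List.perm_iff_count.2 fun e => ?_
      have := (lEnds_chain_perm d q w).count_eq e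
      simp only [expand, expandEdges, lt_irrefl, if_false, List.headD_cons, lVertex, rVertex,
        Grid.lEnds_cons, List.count_append, List.count_cons, List.count_nil, this]
      omega
  · intro v hv
    rcases hcase v hv with ⟨h, h'⟩ | ⟨p, q, rfl, -⟩
    · simp [expand, expandEdges, h]
    · refine List.perm_iff_count.2 fun e => ?_
      have := (rEnds_chain_perm d q w).count_eq e
      simp only [expand, expandEdges, lt_irrefl, if_false, List.headD_cons, lVertex, rVertex,
        Grid.rEnds_cons, List.count_append, List.count_cons, List.count_nil, this]
      omega
  · refine List.nodup_flatMap.2 ⟨fun v hv => ?_, ?_⟩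
    · rcases hcase v hv with ⟨h, h'⟩ | ⟨p, q, rfl, -⟩
      · simp [expandEdges, h]
      · simp [expandEdges, nodup_chainEdges, not_mem_chainEdges]
    · -- the chains of two straddled vertices are told apart by their ends on the RHS
      have hnr : Ω.rEnds.Nodup := hΩ.2.2.nodup_iff.1 hΩ.2.1
      refine (List.nodup_flatMap.1 hnr).2.imp_of_mem fun {u v} hu hv huv => ?_
      intro e heu hev
      obtain ⟨hu2, l, i, he⟩ := mem_expandEdges heu
      obtain ⟨hv2, l', i', he'⟩ := mem_expandEdges hev
      rcases hcase u hu with h | ⟨p, q, rfl, -⟩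
      · omega
      rcases hcase v hv with h | ⟨p', q', rfl, -⟩
      · omega
      rw [he, edge_inj] at he'
      exact huv (a := q) (by simp) (by simpa using he'.1)
  · intro v hv e he he'
    obtain ⟨-, l, i, rfl⟩ := mem_expandEdges he
    exact ne_edge_of_size_lt (hd _ he') _ _ _ rfl
  · intro v hv σ
    rcases hcase v hv with ⟨h, h'⟩ | ⟨p, q, rfl, hp, hq⟩
    · simp only [expand, expandEdges, h, if_true, sumE, prodWeight_cons, prodWeight_nil, mul_one]
      obtain ⟨n, l, r⟩ := v
      match n, h with
      | 0, _ => rfl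
      | 1, _ => rfl
    · have hpe := ne_edge_of_size_lt hp q
      have hqe := ne_edge_of_size_lt hq q
      refine (sumE_link_cons (sumE_chain f g hq w) (fun e he => ⟨?_, ?_, ?_, ?_⟩) (hpe _ _)
        (hqe _ _) (by simp) (by simp) (hpe _ _) (hpe _ _) (hqe _ _) (hqe _ _) (by simp) σ).trans ?_
      · obtain ⟨l, i, rfl, -⟩ := mem_chainEdges he
        exact (hpe _ _).symm
      · exact fun h => not_mem_chainEdges (by omega) (h ▸ he)
      · exact fun h => not_mem_chainEdges (by omega) (h ▸ he)
      · exact fun h => not_mem_chainEdges (by omega) (h ▸ he)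
      · rw [← pow_succ', hM]
        rfl

/-! ### Interpolation -/

/-- The number of straddled vertices, recognized by their label. -/
def Grid.straddledCount (Ω : Grid) : ℕ := (Ω.filter fun v => 2 ≤ v.label).length

/-- Over signatures of which only the straddled one depends on `s` and `z`, in the form
`s (M + z M')`, the Holant value is `s ^ n` times a polynomial of degree at most `n` in `z`, for the
number `n` of straddled vertices. -/
theorem exists_polynomial_holant (f g : Sig) (M M' : Matrix (Fin 2) (Fin 2) ℝ) (Ω : Grid) :
    ∃ p : Polynomial ℝ, p.natDegree ≤ Ω.straddledCount ∧ ∀ s z : ℝ,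
      holant [f, g, straddled (s • (M + z • M'))] Ω = s ^ Ω.straddledCount * p.eval z := by
  have key : ∀ σ : Data → Bool, ∃ p : Polynomial ℝ, p.natDegree ≤ Ω.straddledCount ∧
      ∀ s z : ℝ, prodWeight [f, g, straddled (s • (M + z • M'))] Ω σ =
        s ^ Ω.straddledCount * p.eval z := by
    intro σ
    induction Ω with
    | nil => exact ⟨1, by simp, by simp [Grid.straddledCount]⟩
    | cons v Ω ih =>
      obtain ⟨p, hp, hpe⟩ := ih
      obtain ⟨n, l, r⟩ := v
      match n with
      | 0 =>
        refine ⟨Polynomial.C (f.val (l.map σ) (r.map σ)) * p, ?_, fun s z => ?_⟩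
        · exact (Polynomial.natDegree_C_mul_le _ _).trans (by simpa [Grid.straddledCount] using hp)
        · simp only [prodWeight_cons, hpe, Vertex.weight, Grid.straddledCount,
            List.getElem?_cons_zero, Polynomial.eval_mul, Polynomial.eval_C]
          simp
          ring
      | 1 =>
        refine ⟨Polynomial.C (g.val (l.map σ) (r.map σ)) * p, ?_, fun s z => ?_⟩
        · exact (Polynomial.natDegree_C_mul_le _ _).trans (by simpa [Grid.straddledCount] using hp)
        · simp only [prodWeight_cons, hpe, Vertex.weight, Grid.straddledCount,
            List.getElem?_cons_zero, List.getElem?_cons_succ, Polynomial.eval_mul,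
            Polynomial.eval_C]
          simp
          ring
      | 2 =>
        set i := bit ((l.map σ).headD false)
        set j := bit ((r.map σ).headD false)
        refine ⟨(Polynomial.C (M i j) + Polynomial.C (M' i j) * Polynomial.X) * p, ?_,
          fun s z => ?_⟩
        · refine Polynomial.natDegree_mul_le.trans ?_
          have h1 : (Polynomial.C (M i j) +
              Polynomial.C (M' i j) * Polynomial.X).natDegree ≤ 1 := by
            compute_degree
          have h2 : Grid.straddledCount (⟨2, l, r⟩ :: Ω) = Grid.straddledCount Ω + 1 := by
            simp [Grid.straddledCount]
          omega
        · have hw : Vertex.weight [f, g, straddled (s • (M + z • M'))] σ ⟨2, l, r⟩ =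
              s * (M i j + z * M' i j) := by
            simp [Vertex.weight, straddled, i, j]
          rw [prodWeight_cons, hpe, hw]
          simp [Grid.straddledCount]
          ring
      | n + 3 =>
        refine ⟨0, by simp, fun s z => ?_⟩
        simp [prodWeight_cons, Vertex.weight]
  choose p hp hpe using key
  refine ⟨∑ T ∈ Ω.lEnds.toFinset.powerset, p fun e => decide (e ∈ T),
    Polynomial.natDegree_sum_le_of_forall_le _ _ fun T _ => hp _, fun s z => ?_⟩
  rw [Polynomial.eval_finsetSum, Finset.mul_sum]
  exact Finset.sum_congr rfl fun T _ => hpe _ s z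

theorem pow_succ_ne_one {r : ℝ} (hr : |r| < 1) (i : ℕ) : r ^ (i + 1) ≠ 1 := fun h => by
  have h1 := congrArg abs h
  rw [abs_pow, abs_one] at h1
  exact (pow_lt_one₀ (abs_nonneg _) hr (by omega)).ne h1

/-- The Lagrange interpolation formula at `0` for the nodes `ρ ^ 2, …, ρ ^ (N + 2)`. In this form
it holds for `ρ = 0` too. -/
theorem eval_zero_eq_sum {ρ : ℝ} (hρ : |ρ| < 1) {N : ℕ} {p : Polynomial ℝ}
    (hp : p.natDegree ≤ N) :
    p.eval 0 = ∑ j ∈ Finset.range (N + 1), p.eval (ρ ^ (j + 2)) *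
      ((∏ i ∈ Finset.range j, 1 / (1 - ρ ^ (i + 1))) *
        ∏ i ∈ Finset.range (N - j), ρ ^ (i + 1) / (ρ ^ (i + 1) - 1)) := by
  rcases eq_or_ne ρ 0 with rfl | h0
  · rw [Finset.sum_range_succ, Finset.sum_eq_zero]
    · simp
    · intro j hj
      rw [Finset.mem_range] at hj
      rw [Finset.prod_eq_zero (i := 0) (s := Finset.range (N - j)) (by simpa using by omega)
        (by simp)]
      simp
  · have hinj : Set.InjOn (fun j : ℕ => ρ ^ (j + 2)) (Finset.range (N + 1) : Set ℕ) := by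
      intro i _ j _ hij
      have h := congrArg abs hij
      simp only [abs_pow] at h
      have := (pow_right_strictAnti₀ (abs_pos.2 h0) hρ).injective h
      omega
    have hdeg : p.degree < (Finset.range (N + 1)).card := by
      rw [Finset.card_range]
      exact (Polynomial.degree_le_natDegree).trans_lt (by exact_mod_cast Nat.lt_succ_of_le hp)
    conv_lhs => rw [Lagrange.eq_interpolate hinj hdeg]
    rw [Lagrange.interpolate_apply, Polynomial.eval_finsetSum]
    refine Finset.sum_congr rfl fun j hj => ?_
    rw [Finset.mem_range] at hj
    rw [Polynomial.eval_mul, Polynomial.eval_C, Lagrange.basis, Polynomial.eval_prod]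
    congr 1
    have hsplit : (Finset.range (N + 1)).erase j =
        Finset.range j ∪ Finset.Ico (j + 1) (N + 1) := by
      ext k
      simp only [Finset.mem_erase, Finset.mem_range, Finset.mem_union, Finset.mem_Ico]
      omega
    have hdisj : Disjoint (Finset.range j) (Finset.Ico (j + 1) (N + 1)) := by
      rw [Finset.disjoint_left]
      intro k
      simp only [Finset.mem_range, Finset.mem_Ico]
      omega
    have hne : ∀ i, ρ ^ (i + 1) - 1 ≠ 0 := fun i => sub_ne_zero.2 (pow_succ_ne_one hρ i)
    rw [hsplit, Finset.prod_union hdisj, ← Finset.prod_range_reflect, Finset.prod_Ico_eq_prod_range]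
    congr 1
    · refine Finset.prod_congr rfl fun i hi => ?_
      rw [Finset.mem_range] at hi
      have e : j + 2 = (j - 1 - i + 2) + (i + 1) := by omega
      have := hne i
      have h2 : (1 : ℝ) - ρ ^ (i + 1) ≠ 0 := fun h => this (by linarith)
      simp only [Lagrange.basisDivisor, Polynomial.eval_mul, Polynomial.eval_C,
        Polynomial.eval_sub, Polynomial.eval_X]
      rw [e, pow_add ρ (j - 1 - i + 2)]
      have h3 : ρ ^ (j - 1 - i + 2) ≠ 0 := pow_ne_zero _ h0
      generalize ρ ^ (j - 1 - i + 2) = x at *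
      generalize ρ ^ (i + 1) = y at *
      have : x * y - x ≠ 0 := by
        rw [show x * y - x = x * (y - 1) by ring]; exact mul_ne_zero h3 this
      field_simp
      ring
    · refine Finset.prod_congr (by congr 1; omega) fun i hi => ?_
      have := hne i
      simp only [Lagrange.basisDivisor, Polynomial.eval_mul, Polynomial.eval_C,
        Polynomial.eval_sub, Polynomial.eval_X]
      rw [show j + 1 + i + 2 = (j + 2) + (i + 1) by omega, pow_add ρ (j + 2)]
      have h3 : ρ ^ (j + 2) ≠ 0 := pow_ne_zero _ h0
      generalize ρ ^ (j + 2) = x at *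
      generalize ρ ^ (i + 1) = y at *
      have : x - x * y ≠ 0 := by
        rw [show x - x * y = -(x * (y - 1)) by ring]; exact neg_ne_zero.2 (mul_ne_zero h3 this)
      rw [inv_mul_eq_div, div_eq_div_iff this (by assumption)]
      ring

/-! ### Programs for names of real numbers -/

/-- The sum of two expressions, given as trees. -/
def addF (d e : Data) : Data := .cons (.ofNat 2) (.cons d e)

/-- The difference of two expressions, given as trees. -/
def subF (d e : Data) : Data := .cons (.ofNat 3) (.cons d e)

/-- The product of two expressions, given as trees. -/
def mulF (d e : Data) : Data := .cons (.ofNat 4) (.cons d e)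

/-- The quotient of two expressions, given as trees. -/
def divF (d e : Data) : Data := .cons (.ofNat 5) (.cons d e)

/-- The expression `1`, as a tree. -/
def oneF : Data := Formula.one.toData

namespace IsName

variable {θ : List ℝ} {d e : Data} {r s : ℝ}

theorem one : IsName θ oneF 1 := ⟨_, rfl, .one⟩

theorem const {i : ℕ} (h : θ[i]? = some r) : IsName θ (Formula.const i).toData r :=
  ⟨_, rfl, .const h⟩

theorem add : IsName θ d r → IsName θ e s → IsName θ (addF d e) (r + s) := by
  rintro ⟨f, rfl, hf⟩ ⟨g, rfl, hg⟩
  exact ⟨_, rfl, .add hf hg⟩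

theorem sub : IsName θ d r → IsName θ e s → IsName θ (subF d e) (r - s) := by
  rintro ⟨f, rfl, hf⟩ ⟨g, rfl, hg⟩
  exact ⟨_, rfl, .sub hf hg⟩

theorem mul : IsName θ d r → IsName θ e s → IsName θ (mulF d e) (r * s) := by
  rintro ⟨f, rfl, hf⟩ ⟨g, rfl, hg⟩
  exact ⟨_, rfl, .mul hf hg⟩

theorem div : IsName θ d r → IsName θ e s → s ≠ 0 → IsName θ (divF d e) (r / s) := by
  rintro ⟨f, rfl, hf⟩ ⟨g, rfl, hg⟩ h
  exact ⟨_, rfl, .div hf hg h⟩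

end IsName

theorem AddsPoly.of_le {H K : (Data → Data) → Data → Data} (hK : PolyTime K)
    (h : ∀ O u e l v, (H O (.cons u (.cons (.cons e l) v))).size ≤
      v.size + (K O (.cons u (.cons e l))).size) : AddsPoly H := by
  intro q
  obtain ⟨p, hp⟩ := hK.size_le q
  refine ⟨p.comp (Polynomial.X + 1), fun O hO u e l v => (h O u e l v).trans ?_⟩
  have := hp O hO (.cons u (.cons e l))
  simp only [Polynomial.eval_comp, Polynomial.eval_add, Polynomial.eval_X, Polynomial.eval_one,
    Data.size] at this ⊢
  omega

/-- The power of an expression, with the exponent given by the length of `w`. -/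
def powF (b w : Data) : Data := w.fold (fun _ => oneF) (fun x => mulF x.fst x.snd.snd) b

/-- An expression for `∏ i ∈ range w.len, 1 / (1 - ρ ^ (i + 1))`. -/
def coeffA (ρ w : Data) : Data :=
  w.fold (fun _ => oneF) (fun x => divF x.snd.snd (subF oneF (powF x.fst x.snd.fst))) ρ

/-- An expression for `∏ i ∈ range w.len, ρ ^ (i + 1) / (ρ ^ (i + 1) - 1)`. -/
def coeffB (ρ w : Data) : Data :=
  w.fold (fun _ => oneF) (fun x => mulF x.snd.snd (divF (powF x.fst x.snd.fst)
    (subF (powF x.fst x.snd.fst) oneF))) ρ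

namespace IsName

variable {θ : List ℝ} {d : Data} {r : ℝ}

theorem pow (h : IsName θ d r) (w : Data) : IsName θ (powF d w) (r ^ w.len) := by
  induction w with
  | nil => exact one
  | cons e l _ ih =>
    rw [Data.len, pow_succ']
    exact h.mul ih

theorem coeffA (h : IsName θ d r) (hr : |r| < 1) (w : Data) :
    IsName θ (coeffA d w) (∏ i ∈ Finset.range w.len, 1 / (1 - r ^ (i + 1))) := by
  induction w with
  | nil => exact one
  | cons e l _ ih =>
    rw [Data.len, Finset.prod_range_succ, mul_one_div]
    exact ih.div (one.sub (h.pow (.cons e l))) (sub_ne_zero.2 (pow_succ_ne_one hr _).symm)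

theorem coeffB (h : IsName θ d r) (hr : |r| < 1) (w : Data) :
    IsName θ (coeffB d w)
      (∏ i ∈ Finset.range w.len, r ^ (i + 1) / (r ^ (i + 1) - 1)) := by
  induction w with
  | nil => exact one
  | cons e l _ ih =>
    rw [Data.len, Finset.prod_range_succ]
    exact ih.mul ((h.pow (.cons e l)).div ((h.pow (.cons e l)).sub one)
      (sub_ne_zero.2 (pow_succ_ne_one hr _)))

end IsName

namespace PolyTime

variable {F G : (Data → Data) → Data → Data}

theorem addF (hF : PolyTime F) (hG : PolyTime G) : PolyTime fun O d => addF (F O d) (G O d) :=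
  cons (const _) (cons hF hG)

theorem subF (hF : PolyTime F) (hG : PolyTime G) : PolyTime fun O d => subF (F O d) (G O d) :=
  cons (const _) (cons hF hG)

theorem mulF (hF : PolyTime F) (hG : PolyTime G) : PolyTime fun O d => mulF (F O d) (G O d) :=
  cons (const _) (cons hF hG)

theorem divF (hF : PolyTime F) (hG : PolyTime G) : PolyTime fun O d => divF (F O d) (G O d) :=
  cons (const _) (cons hF hG)

theorem powF (hF : PolyTime F) (hG : PolyTime G) : PolyTime fun O d => powF (F O d) (G O d) :=
  fold (const oneF) (mulF id.fst id.snd.snd)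
    (.of_le (mulF id.fst id.fst) fun O u e l v => by
      simp only [BipHolant.mulF, Data.size, Data.fst, Data.snd]
      have := u.one_le_size
      omega) hF hG

theorem coeffA (hF : PolyTime F) (hG : PolyTime G) :
    PolyTime fun O d => coeffA (F O d) (G O d) :=
  fold (const oneF) (divF id.snd.snd (subF (const oneF) (powF id.fst id.snd.fst)))
    (.of_le (divF nil (subF (const oneF) (powF id.fst id.snd))) fun O u e l v => by
      simp only [BipHolant.divF, Data.size, Data.fst, Data.snd]
      omega) hF hG

theorem coeffB (hF : PolyTime F) (hG : PolyTime G) :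
    PolyTime fun O d => coeffB (F O d) (G O d) :=
  have h : PolyTime fun _ d => BipHolant.powF d.fst d.snd := powF id.fst id.snd
  fold (const oneF) (mulF id.snd.snd (divF (powF id.fst id.snd.fst)
      (subF (powF id.fst id.snd.fst) (const oneF))))
    (.of_le (mulF nil (divF h (subF h (const oneF)))) fun O u e l v => by
      simp only [BipHolant.mulF, Data.size, Data.fst, Data.snd]
      omega) hF hG

end PolyTime

/-! ### Programs for grids -/

theorem ofNat_snd_eq_nil {n : ℕ} : (Data.ofNat n).snd = Data.nil ↔ n < 2 := by
  match n with
  | 0 => simp [Data.ofNat, Data.snd]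
  | 1 => simp [Data.ofNat, Data.snd]
  | n + 2 => simp [Data.ofNat, Data.snd]

@[simp]
theorem Data.fst_cons (d e : Data) : (Data.cons d e).fst = d := rfl

@[simp]
theorem Data.snd_cons (d e : Data) : (Data.cons d e).snd = e := rfl

theorem ofList_fst (L : List Data) : (Data.ofList L).fst = L.headD .nil := by
  cases L <;> rfl

theorem len_ofList (L : List Data) : (Data.ofList L).len = L.length := by
  induction L with
  | nil => rfl
  | cons d L ih => simp [Data.ofList, Data.len, ih]

/-- Concatenation of lists. -/
def appendD (d e : Data) : Data := d.fold (fun u => u) (fun x => .cons x.snd.fst.fst x.snd.snd) e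

theorem appendD_ofList (L L' : List Data) :
    appendD (.ofList L) (.ofList L') = .ofList (L ++ L') := by
  induction L with
  | nil => rfl
  | cons d L ih => exact congrArg (Data.cons d) ih

theorem size_appendD_le (d e : Data) : (appendD d e).size ≤ d.size + e.size := by
  induction d with
  | nil => simp [appendD, Data.fold]
  | cons a l _ ih =>
    simp only [appendD, Data.fold, Data.size, Data.fst, Data.snd] at ih ⊢
    omega

/-- Concatenation of the values of `h` at the elements of a list, with a parameter. -/
def flatMapD (h : Data → Data) (u d : Data) : Data :=
  d.fold (fun _ => .nil) (fun x => appendD (h (.cons x.fst x.snd.fst.fst)) x.snd.snd) u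

theorem flatMapD_ofList (h : Data → Data) (u : Data) {α : Type*} (f : α → Data)
    (F : α → List Data) (L : List α) (hF : ∀ v ∈ L, h (.cons u (f v)) = .ofList (F v)) :
    flatMapD h u (.ofList (L.map f)) = .ofList (L.flatMap F) := by
  induction L with
  | nil => rfl
  | cons v L ih =>
    have := ih fun v hv => hF v (List.mem_cons_of_mem _ hv)
    rw [List.flatMap_cons, ← appendD_ofList, ← this, ← hF v List.mem_cons_self]
    rfl

namespace PolyTime

variable {F G H : (Data → Data) → Data → Data}

theorem appendD (hF : PolyTime F) (hG : PolyTime G) :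
    PolyTime fun O d => appendD (F O d) (G O d) :=
  fold id (cons id.snd.fst.fst id.snd.snd) (.of_le id.snd fun O u e l v => by
    simp only [Data.size, Data.fst, Data.snd]
    omega) hG hF

theorem flatMapD (hH : PolyTime H) (hF : PolyTime F) (hG : PolyTime G) :
    PolyTime fun O d => flatMapD (H O) (F O d) (G O d) :=
  fold nil (appendD (hH.comp (cons id.fst id.snd.fst.fst)) id.snd.snd)
    (.of_le (hH.comp (cons id.fst id.snd.fst)) fun _ _ _ _ _ =>
      (size_appendD_le _ _).trans (add_comm _ _).le) hF hG

end PolyTime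

/-! ### The program for the grids with chains -/

namespace PolyTime

variable {D Q W E₁ E₂ E₃ : (Data → Data) → Data → Data}

theorem edge (hD : PolyTime D) (hQ : PolyTime Q) (hW : PolyTime W) (i : ℕ) :
    PolyTime fun O x => edge (D O x) (Q O x) (W O x) i :=
  cons hD (cons hW (cons (const _) hQ))

theorem lVertex (h₁ : PolyTime E₁) (h₂ : PolyTime E₂) (h₃ : PolyTime E₃) :
    PolyTime fun O x => (lVertex (E₁ O x) (E₂ O x) (E₃ O x)).toData :=
  cons (const _) (cons (cons h₁ (cons h₂ (cons h₃ nil))) nil)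

theorem rVertex (h₁ : PolyTime E₁) (h₂ : PolyTime E₂) (h₃ : PolyTime E₃) :
    PolyTime fun O x => (rVertex (E₁ O x) (E₂ O x) (E₃ O x)).toData :=
  cons (const _) (cons nil (cons h₁ (cons h₂ (cons h₃ nil))))

end PolyTime

theorem Grid.toData_cons (v : Vertex) (Ω : Grid) :
    Grid.toData (v :: Ω) = .cons v.toData (Grid.toData Ω) := rfl

theorem toData_chain (d q w : Data) : (chain d q w).toData = w.fold
    (fun u => .cons
      (lVertex (edge u.fst u.snd .nil 2) (edge u.fst u.snd .nil 0) (edge u.fst u.snd .nil 1)).toData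
      (.cons (rVertex (edge u.fst u.snd .nil 0) (edge u.fst u.snd .nil 1) u.snd).toData .nil))
    (fun x => .cons
      (lVertex (edge x.fst.fst x.fst.snd x.snd.fst 2) (edge x.fst.fst x.fst.snd x.snd.fst 0)
        (edge x.fst.fst x.fst.snd x.snd.fst 1)).toData
      (.cons (rVertex (edge x.fst.fst x.fst.snd x.snd.fst 0)
        (edge x.fst.fst x.fst.snd x.snd.fst 1)
        (edge x.fst.fst x.fst.snd x.snd.fst.snd 2)).toData x.snd.snd))
    (.cons d q) := by
  induction w with
  | nil => rfl
  | cons e l _ ih => rw [chain, Grid.toData_cons, Grid.toData_cons, ih]; rfl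

theorem PolyTime.chain {D Q W : (Data → Data) → Data → Data} (hD : PolyTime D) (hQ : PolyTime Q)
    (hW : PolyTime W) : PolyTime fun O x => (chain (D O x) (Q O x) (W O x)).toData := by
  simp only [toData_chain]
  have h (i : ℕ) : PolyTime fun _ x =>
      BipHolant.edge x.fst.fst x.fst.snd x.snd.fst i := edge id.fst.fst id.fst.snd id.snd.fst i
  have h' (i : ℕ) : PolyTime fun _ x =>
      BipHolant.edge x.fst.fst x.fst.snd x.snd i := edge id.fst.fst id.fst.snd id.snd i
  have h'' (i : ℕ) : PolyTime fun _ x =>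
      BipHolant.edge x.fst x.snd .nil i := edge id.fst id.snd nil i
  refine fold (cons (lVertex (h'' 2) (h'' 0) (h'' 1)) (cons (rVertex (h'' 0) (h'' 1) id.snd) nil))
    (cons (lVertex (h 2) (h 0) (h 1)) (cons (rVertex (h 0) (h 1)
      (edge id.fst.fst id.fst.snd id.snd.fst.snd 2)) id.snd.snd))
    (.of_le (cons (lVertex (h' 2) (h' 0) (h' 1)) (cons (rVertex (h' 0) (h' 1)
      (edge id.fst.fst id.fst.snd id.snd.snd 2)) nil)) fun O u e l v => ?_) (cons hD hQ) hW
  simp only [Data.size, Data.fst, Data.snd]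
  omega

/-- The list of vertices that replace a vertex, given `(d, w)` and the vertex. -/
def expandD (x : Data) : Data :=
  if x.snd.fst.snd = .nil then .cons x.snd .nil else
    .cons (lVertex x.snd.snd.fst.fst (edge x.fst.fst x.snd.snd.snd.fst x.fst.snd 3)
        (edge x.fst.fst x.snd.snd.snd.fst x.fst.snd 4)).toData
      (.cons (rVertex (edge x.fst.fst x.snd.snd.snd.fst x.fst.snd 3)
        (edge x.fst.fst x.snd.snd.snd.fst x.fst.snd 4)
        (edge x.fst.fst x.snd.snd.snd.fst x.fst.snd 2)).toData
      (chain x.fst.fst x.snd.snd.snd.fst x.fst.snd).toData)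

theorem PolyTime.expandD : PolyTime fun _ x => expandD x := by
  have h (i : ℕ) : PolyTime fun _ x =>
      BipHolant.edge x.fst.fst x.snd.snd.snd.fst x.fst.snd i :=
    edge id.fst.fst id.snd.snd.snd.fst id.fst.snd i
  exact ite id.snd.fst.snd (cons id.snd nil) (cons (lVertex id.snd.snd.fst.fst (h 3) (h 4))
    (cons (rVertex (h 3) (h 4) (h 2)) (chain id.fst.fst id.snd.snd.snd.fst id.fst.snd)))

theorem expandD_toData (d w : Data) (v : Vertex) :
    expandD (.cons (.cons d w) v.toData) = (expand d w v).toData := by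
  have h₁ : v.toData.fst.snd = .nil ↔ v.label < 2 := ofNat_snd_eq_nil
  have h₂ : v.toData.snd.fst.fst = v.lEnds.headD .nil := ofList_fst _
  have h₃ : v.toData.snd.snd.fst = v.rEnds.headD .nil := ofList_fst _
  simp only [expandD, Data.fst_cons, Data.snd_cons, h₁, h₂, h₃, expand]
  split <;> rfl

theorem flatMapD_expandD (d w : Data) (Ω : Grid) :
    flatMapD expandD (.cons d w) Ω.toData = Grid.toData (Ω.flatMap (expand d w)) := by
  rw [Grid.toData, flatMapD_ofList expandD _ Vertex.toData
    (fun v => List.map Vertex.toData (expand d w v)) Ω fun v _ => expandD_toData d w v,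
    Grid.toData, List.map_flatMap]

/-! ### The program for interpolation -/

/-- An expression for the power of `μ` whose exponent is the number of straddled vertices. -/
def scaleF (μ d : Data) : Data :=
  d.fold (fun _ => oneF)
    (fun x => if x.snd.fst.fst.fst.snd = .nil then x.snd.snd else mulF x.fst x.snd.snd) μ

/-- Remove as many elements from the list `d` as the list `w` has. -/
def dropD (w d : Data) : Data := w.fold (fun u => u) (fun x => x.snd.snd.snd) d

theorem len_dropD (w d : Data) : (dropD w d).len = d.len - w.len := by
  induction w with
  | nil => rfl
  | cons e l _ ih =>
    have hs : ∀ x : Data, x.snd.len = x.len - 1 := fun x => by cases x <;> rfl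
    change (dropD l d).snd.len = _
    rw [hs, ih, Data.len]
    omega

theorem IsName.scaleF {θ : List ℝ} {m : Data} {μ : ℝ} (h : IsName θ m μ) (Ω : Grid) :
    IsName θ (scaleF m Ω.toData) (μ ^ Ω.straddledCount) := by
  induction Ω with
  | nil => exact one
  | cons v Ω ih =>
    have hv : BipHolant.scaleF m (Grid.toData (v :: Ω)) =
        if (Data.ofNat v.label).snd = .nil then BipHolant.scaleF m (Grid.toData Ω)
        else mulF m (BipHolant.scaleF m (Grid.toData Ω)) := rfl
    rw [hv]
    by_cases hl : v.label < 2
    · rw [if_pos (ofNat_snd_eq_nil.2 hl)]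
      have : Grid.straddledCount (v :: Ω) = Grid.straddledCount Ω := by
        simp [Grid.straddledCount, hl]
      rwa [this]
    · rw [if_neg (mt ofNat_snd_eq_nil.1 hl)]
      have : Grid.straddledCount (v :: Ω) = Grid.straddledCount Ω + 1 := by
        simp [Grid.straddledCount, not_lt.1 hl]
      rw [this, pow_succ']
      exact h.mul ih

theorem PolyTime.scaleF {F G : (Data → Data) → Data → Data} (hF : PolyTime F) (hG : PolyTime G) :
    PolyTime fun O d => scaleF (F O d) (G O d) :=
  fold (const oneF) (ite id.snd.fst.fst.fst.snd id.snd.snd (mulF id.fst id.snd.snd))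
    (.of_le (mulF id.fst id.fst) fun O u e l v => by
      have := u.one_le_size
      split <;> simp only [BipHolant.mulF, Data.size, Data.fst, Data.snd] <;> omega) hF hG

theorem PolyTime.dropD {F G : (Data → Data) → Data → Data} (hF : PolyTime F) (hG : PolyTime G) :
    PolyTime fun O d => dropD (F O d) (G O d) :=
  fold id id.snd.snd.snd (.of_le nil fun O u e l v => by
    have := v.size_snd_le
    simp only [Data.snd] at this ⊢
    omega) hG hF

/-- One summand of the interpolation formula: the input is the grid and a list, whose length is the
index of the summand. -/
def termF (ρ μ : Data) (O : Data → Data) (x : Data) : Data :=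
  mulF (divF (O (flatMapD expandD x x.fst)) (powF (scaleF μ x.fst) (.cons .nil (.cons .nil x.snd))))
    (mulF (coeffA ρ x.snd) (coeffB ρ (dropD x.snd x.fst)))

/-- The interpolation formula. -/
def interpolateF (ρ μ : Data) (O : Data → Data) (d : Data) : Data :=
  d.fold (fun d => termF ρ μ O (.cons d .nil))
    (fun x => addF (termF ρ μ O (.cons x.fst x.snd.fst)) x.snd.snd) d

theorem PolyTime.termF (ρ μ : Data) : PolyTime (termF ρ μ) :=
  mulF (divF (query (flatMapD expandD id id.fst))
    (powF (scaleF (const μ) id.fst) (cons nil (cons nil id.snd))))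
    (mulF (coeffA (const ρ) id.snd) (coeffB (const ρ) (dropD id.snd id.fst)))

theorem PolyTime.interpolateF (ρ μ : Data) : PolyTime (interpolateF ρ μ) :=
  fold ((termF ρ μ).comp (cons id nil))
    (addF ((termF ρ μ).comp (cons id.fst id.snd.fst)) id.snd.snd)
    (.of_le (addF ((termF ρ μ).comp id) nil) fun O u e l v => by
      simp only [BipHolant.addF, Data.size, Data.fst, Data.snd]
      omega) id id

theorem Data.size_le_ofList {d : Data} {L : List Data} (h : d ∈ L) :
    d.size < (Data.ofList L).size := by
  induction L with
  | nil => simp at h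
  | cons e L ih =>
    simp only [Data.ofList, Data.size]
    rcases List.mem_cons.1 h with rfl | h
    · omega
    · have := ih h
      omega

theorem Grid.size_lt_of_mem_lEnds {Ω : Grid} {e : Data} (h : e ∈ Ω.lEnds) :
    e.size < Ω.toData.size := by
  obtain ⟨v, hv, he⟩ := List.mem_flatMap.1 h
  have h1 := Data.size_le_ofList he
  have h2 : v.toData.size < Ω.toData.size :=
    Data.size_le_ofList (List.mem_map.2 ⟨v, hv, rfl⟩)
  simp only [Vertex.toData, Data.size] at h2
  omega

theorem Grid.WellFormed.straddled_congr {f g : Sig} {M : Matrix (Fin 2) (Fin 2) ℝ} {Ω : Grid}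
    (h : Ω.WellFormed [f, g, straddled M]) (M' : Matrix (Fin 2) (Fin 2) ℝ) :
    Ω.WellFormed [f, g, straddled M'] := by
  refine ⟨fun v hv => ?_, h.2⟩
  obtain ⟨n, l, r⟩ := v
  obtain ⟨s, hs, h1, h2⟩ := h.1 _ hv
  match n, hs with
  | 0, hs => exact ⟨s, hs, h1, h2⟩
  | 1, hs => exact ⟨s, hs, h1, h2⟩
  | 2, hs =>
    obtain rfl : straddled M = s := by simpa using hs
    exact ⟨_, rfl, h1, h2⟩

/-- A straddled signature `M` can be interpolated if the powers of the binary gadget, up to scaling,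
converge to `M` in the form `M + ρ ^ k M'`. -/
theorem isName_interpolateF {f g : Sig} (hf : f.l = 3 ∧ f.r = 0) (hg : g.l = 0 ∧ g.r = 3)
    {θ : List ℝ} {M M' : Matrix (Fin 2) (Fin 2) ℝ} {ρ μ : ℝ} (hρ : |ρ| < 1) (hμ : μ ≠ 0)
    (hG : ∀ k, gadgetG1 f g ^ k = μ ^ k • (M + ρ ^ k • M')) {ρd μd : Data}
    (hρd : IsName θ ρd ρ) (hμd : IsName θ μd μ) {q : Polynomial ℕ} {O : Data → Data}
    (hO : Solves θ q O (Holant [f, g])) {d : Data} {r : ℝ}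
    (h : Holant [f, g, straddled M] d r) : IsName θ (interpolateF ρd μd O d) r := by
  obtain ⟨Ω, hΩ, rfl, rfl⟩ := h
  obtain ⟨p, hp, hpe⟩ := exists_polynomial_holant f g M M' Ω
  set n := Ω.straddledCount
  set N := Ω.length
  have hnN : n ≤ N := List.length_filter_le _ _
  have hlen : Ω.toData.len = N := by rw [Grid.toData, len_ofList, List.length_map]
  have hterm : ∀ w, IsName θ (termF ρd μd O (.cons Ω.toData w)) (p.eval (ρ ^ (w.len + 2)) *
      ((∏ i ∈ Finset.range w.len, 1 / (1 - ρ ^ (i + 1))) *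
        ∏ i ∈ Finset.range (N - w.len), ρ ^ (i + 1) / (ρ ^ (i + 1) - 1))) := by
    intro w
    have h1 := holant_expand (d := Ω.toData) (w := w) hf hg rfl (hΩ.straddled_congr _)
      fun e he => Grid.size_lt_of_mem_lEnds he
    have h2 := hO.2 _ _ ⟨_, h1.1, rfl, rfl⟩
    rw [h1.2, hG, hpe, ← flatMapD_expandD] at h2
    -- dividing by `μ ^ (n (k + 2))`, for `k = w.len`, leaves the value of `p` at `ρ ^ (k + 2)`
    have h3 : (μ ^ n) ^ (w.len + 2) ≠ 0 := pow_ne_zero _ (pow_ne_zero _ hμ)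
    have h4 := h2.div ((hμd.scaleF Ω).pow (.cons .nil (.cons .nil w))) h3
    have h5 : (μ ^ (w.len + 2)) ^ n * p.eval (ρ ^ (w.len + 2)) / (μ ^ n) ^ (w.len + 2) =
        p.eval (ρ ^ (w.len + 2)) := by
      rw [pow_right_comm] at h3 ⊢
      field_simp
    rw [← hlen, ← len_dropD, ← h5]
    exact h4.mul ((hρd.coeffA hρ w).mul (hρd.coeffB hρ (dropD w Ω.toData)))
  have hsum : ∀ w : Data, IsName θ (w.fold (fun d => termF ρd μd O (.cons d .nil))
      (fun x => addF (termF ρd μd O (.cons x.fst x.snd.fst)) x.snd.snd) Ω.toData)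
      (∑ j ∈ Finset.range (w.len + 1), p.eval (ρ ^ (j + 2)) *
        ((∏ i ∈ Finset.range j, 1 / (1 - ρ ^ (i + 1))) *
          ∏ i ∈ Finset.range (N - j), ρ ^ (i + 1) / (ρ ^ (i + 1) - 1))) := by
    intro w
    induction w with
    | nil =>
      rw [Data.len, zero_add, Finset.sum_range_one]
      exact hterm .nil
    | cons e l _ ih =>
      rw [Data.len, Finset.sum_range_succ, add_comm]
      exact (hterm (.cons e l)).add ih
  have h0 : holant [f, g, straddled M] Ω = p.eval 0 := by
    have := hpe 1 0
    simpa using this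
  have hN := hsum Ω.toData
  rw [hlen, ← eval_zero_eq_sum hρ (hp.trans hnN), ← h0] at hN
  exact hN

/-! ### Splitting a degenerate straddled signature -/

/-- The three ends of a triple. -/
def ends (t : Data × Data × Data) : List Data := [t.1, t.2.1, t.2.2]

/-- The ternary vertices that are attached to triples of edges by `mk`. -/
def attach (mk : Data → Data → Data → Vertex) (T : List (Data × Data × Data)) : Grid :=
  T.map fun t => mk t.1 t.2.1 t.2.2

/-- Suppose that the vertices of `Ω` get new ends `new v`, so that their weights get a factor `ω`
for each new end, and that the new ends are distributed in triples to new ternary vertices. Then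
the Holant value is multiplied by a constant for each triple. -/
theorem holant_attach {S S' : List Sig} {Ω : Grid} (hΩ : Ω.WellFormed S) (ex : Vertex → Vertex)
    (new : Vertex → List Data) {T : List (Data × Data × Data)} {mk : Data → Data → Data → Vertex}
    (hT : (Ω.flatMap new).Perm (T.flatMap ends)) (hfit : ∀ v ∈ Ω, (ex v).Fits S')
    (hmk : ∀ e₁ e₂ e₃, (mk e₁ e₂ e₃).Fits S')
    (hl : (Grid.lEnds (attach mk T ++ Ω.map ex)).Perm (Ω.lEnds ++ Ω.flatMap new))
    (hr : (Grid.rEnds (attach mk T ++ Ω.map ex)).Perm (Ω.rEnds ++ Ω.flatMap new))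
    (hn : (Ω.flatMap new).Nodup) (hd : ∀ e ∈ Ω.flatMap new, e ∉ Ω.lEnds) (ω : Bool → ℝ)
    (hw : ∀ v ∈ Ω, ∀ σ : Data → Bool,
      (ex v).weight S' σ = v.weight S σ * ((new v).map fun e => ω (σ e)).prod) {C : ℝ}
    (hdep : ∀ e₁ e₂ e₃, DependsOn (fun σ => (mk e₁ e₂ e₃).weight S' σ) {e₁, e₂, e₃})
    (hC : ∀ e₁ e₂ e₃ : Data, e₁ ≠ e₂ → e₁ ≠ e₃ → e₂ ≠ e₃ → ∀ σ, sumE [e₁, e₂, e₃]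
      (fun τ => ω (τ e₁) * ω (τ e₂) * ω (τ e₃) * (mk e₁ e₂ e₃).weight S' τ) σ = C) :
    Grid.WellFormed S' (attach mk T ++ Ω.map ex) ∧
      holant S' (attach mk T ++ Ω.map ex) = holant S Ω * C ^ T.length := by
  obtain ⟨-, hnl, hlr⟩ := hΩ
  have hnod : (Ω.lEnds ++ Ω.flatMap new).Nodup :=
    List.nodup_append'.2 ⟨hnl, hn, fun e he he' => hd e he' he⟩
  refine ⟨⟨fun v hv => ?_, hl.nodup_iff.2 hnod, hl.trans ((hlr.append_right _).trans hr.symm)⟩, ?_⟩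
  · rcases List.mem_append.1 hv with hv | hv
    · obtain ⟨t, -, rfl⟩ := List.mem_map.1 hv
      exact hmk _ _ _
    · obtain ⟨u, hu, rfl⟩ := List.mem_map.1 hv
      exact hfit u hu
  · rw [holant_eq_sumE (hl.nodup_iff.2 hnod) hl, holant_eq_sumE hnl (List.Perm.refl _),
      sumE_append, mul_comm, ← sumE_const_mul]
    refine sumE_congr fun τ hτ => ?_
    let g : Data × Data × Data → (Data → Bool) → ℝ := fun t τ =>
      ω (τ t.1) * ω (τ t.2.1) * ω (τ t.2.2) * (mk t.1 t.2.1 t.2.2).weight S' τ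
    have hmap : ∀ σ : Data → Bool, prodWeight S' (Ω.map ex) σ =
        prodWeight S Ω σ * ((Ω.flatMap new).map fun e => ω (σ e)).prod := by
      intro σ
      clear hT hl hr hn hd hnl hlr hnod hfit hτ
      induction Ω with
      | nil => simp
      | cons v Ω ih =>
        rw [List.map_cons, prodWeight_cons, prodWeight_cons, hw v List.mem_cons_self,
          ih fun u hu => hw u (List.mem_cons_of_mem _ hu), List.flatMap_cons, List.map_append,
          List.prod_append]
        ring
    have hsplit : prodWeight S' (attach mk T ++ Ω.map ex) =
        fun σ => prodWeight S Ω σ * (T.map fun t => g t σ).prod := by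
      funext σ
      rw [prodWeight_append, hmap, (hT.map _).prod_eq]
      have : prodWeight S' (attach mk T) σ * ((T.flatMap ends).map fun e => ω (σ e)).prod =
          (T.map fun t => g t σ).prod := by
        clear hT hl hr
        induction T with
        | nil => simp [attach]
        | cons t T ih =>
          rw [List.map_cons, List.prod_cons, ← ih, attach, List.map_cons, prodWeight_cons,
            List.flatMap_cons, List.map_append, List.prod_append]
          simp only [ends, List.map_cons, List.map_nil, List.prod_cons, List.prod_nil, g, attach]
          ring
      rw [← this]
      ring
    have hnT : (T.flatMap ends).Nodup := hT.nodup_iff.1 hn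
    rw [hsplit, sumE_mul_of_dependsOn (dependsOn_prodWeight S Ω), mul_comm, sumE_perm hT hn,
      sumE_flatMap T ends g ∅ ?_ (by simp) hnT, List.map_congr_left (g := fun _ => C),
      List.map_const', List.prod_replicate]
    · intro t ht
      have := (List.nodup_flatMap.1 hnT).1 t ht
      simp only [ends, List.nodup_cons, List.mem_cons, List.not_mem_nil, or_false, not_or] at this
      exact hC _ _ _ this.1.1 this.1.2 this.2.1 τ
    · intro t ht σ τ h
      have h1 := h t.1 (by simp [ends])
      have h2 := h t.2.1 (by simp [ends])
      have h3 := h t.2.2 (by simp [ends])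
      have h4 := hdep t.1 t.2.1 t.2.2 (x := σ) (y := τ) (by
        rintro e (rfl | rfl | rfl)
        exacts [h1, h2, h3])
      simp only [g, h1, h2, h3] at h4 ⊢
      rw [h4]
    · rintro e he (h | h)
      · exact hd e he h
      · exact hd e he (hlr.mem_iff.2 h)

/-- Distribute the elements of a list into triples; at most two elements are left over. -/
def group : List Data → List Data × List (Data × Data × Data)
  | [] => ([], [])
  | e :: L =>
    match group L with
    | (p :: p' :: _, T) => ([], (e, p, p') :: T)
    | (P, T) => (e :: P, T)

theorem group_spec (L : List Data) : (group L).1.length ≤ 2 ∧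
    L.Perm ((group L).1 ++ (group L).2.flatMap ends) := by
  induction L with
  | nil => simp [group]
  | cons e L ih =>
    obtain ⟨h1, h2⟩ := ih
    rw [group]
    split
    · next p p' P T h =>
      rw [h] at h1 h2
      obtain rfl : P = [] := by
        rw [← List.length_eq_zero_iff]
        simp only [List.length_cons] at h1
        omega
      exact ⟨by simp, by simpa [ends] using h2⟩
    · next P T hne h =>
      rw [h] at h1 h2
      refine ⟨?_, by simpa using h2⟩
      match P, hne with
      | [], _ => simp
      | [p], _ => simp
      | p :: p' :: P, hne => exact (hne p p' P rfl).elim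

theorem perm_flatMap_group {L : List Data} (h : 3 ∣ L.length) :
    L.Perm ((group L).2.flatMap ends) := by
  obtain ⟨h1, h2⟩ := group_spec L
  have hlen : ∀ T : List (Data × Data × Data), (T.flatMap ends).length = 3 * T.length := by
    intro T
    induction T with
    | nil => simp
    | cons t T ih => simp only [List.flatMap_cons, List.length_append, ih, ends, List.length_cons,
        List.length_nil]; ring
  have h3 := h2.length_eq
  rw [List.length_append, hlen] at h3
  have h4 : (group L).1 = [] := List.length_eq_zero_iff.1 (by omega)
  rwa [h4, List.nil_append] at h2

/-- The program for `group`: its value is the pair of the elements left over and of the vertices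
that are attached to the triples. -/
def groupD (mk : Data → Data → Data → Vertex) (d : Data) : Data :=
  d.fold (fun _ => .cons .nil .nil) (fun x => if x.snd.snd.fst.snd = .nil
    then .cons (.cons x.snd.fst.fst x.snd.snd.fst) x.snd.snd.snd
    else .cons .nil (.cons (mk x.snd.fst.fst x.snd.snd.fst.fst x.snd.snd.fst.snd.fst).toData
      x.snd.snd.snd)) .nil

theorem groupD_ofList (mk : Data → Data → Data → Vertex) (L : List Data) :
    groupD mk (.ofList L) = .cons (.ofList (group L).1) (attach mk (group L).2).toData := by
  induction L with
  | nil => rfl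
  | cons e L ih =>
    have h : groupD mk (.ofList (e :: L)) = if (groupD mk (.ofList L)).fst.snd = .nil
      then .cons (.cons e (groupD mk (.ofList L)).fst) (groupD mk (.ofList L)).snd
      else .cons .nil (.cons (mk e (groupD mk (.ofList L)).fst.fst
        (groupD mk (.ofList L)).fst.snd.fst).toData (groupD mk (.ofList L)).snd) := rfl
    rw [h, ih, group]
    obtain ⟨P, T⟩ := group L
    match P with
    | [] => rfl
    | [p] => rfl
    | p :: p' :: P => simp [Data.ofList, attach, Grid.toData]

theorem PolyTime.groupD {mk : Data → Data → Data → Vertex}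
    (hmk : PolyTime fun _ x => (mk x.fst x.snd.fst x.snd.snd).toData)
    (hsize : ∀ e₁ e₂ e₃, (mk e₁ e₂ e₃).toData.size ≤ e₁.size + e₂.size + e₃.size + 20)
    {F : (Data → Data) → Data → Data} (hF : PolyTime F) :
    PolyTime fun O x => groupD mk (F O x) := by
  have h := hmk.comp (cons id.snd.fst.fst (cons id.snd.snd.fst.fst id.snd.snd.fst.snd.fst))
  refine fold (cons nil nil) (ite id.snd.snd.fst.snd
    (cons (cons id.snd.fst.fst id.snd.snd.fst) id.snd.snd.snd)
    (cons nil (cons h id.snd.snd.snd)))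
    (.of_le (cons id.snd (const (.ofNat 20))) fun O u e l v => ?_) nil hF
  have h20 : (Data.ofNat 20).size = 41 := rfl
  simp only [Data.fst_cons, Data.snd_cons]
  have h1 := hsize e v.fst.fst v.fst.snd.fst
  cases v with
  | nil => simp only [Data.fst, Data.snd, if_true, Data.size, h20]; omega
  | cons p o =>
    simp only [Data.fst_cons, Data.snd_cons] at h1 ⊢
    cases p with
    | nil => simp only [Data.snd, if_true, Data.size, h20]; omega
    | cons p p' =>
      simp only [Data.fst_cons, Data.snd_cons] at h1 ⊢
      have := p'.size_fst_le
      change (if p' = .nil then Data.cons (.cons e (.cons p p')) o else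
        .cons .nil (.cons (mk e p p'.fst).toData o)).size ≤ _
      split <;> simp only [Data.size, h20] <;> omega

/-- The new ends of a vertex `v`, if `v` is replaced by `ex d v`: none, unless the replacement is a
straddled vertex, recognized by its label, and then its end `en`. The tree `d` serves to name the
new ends. -/
def newEnds (ex : Data → Vertex → Vertex) (en : Vertex → Data) (d : Data) (v : Vertex) :
    List Data :=
  if (ex d v).label < 2 then [] else [en (ex d v)]

/-- A reduction that replaces unary vertices by straddled ones with a new end, attaches ternary
vertices to the new ends, and divides the Holant value by a constant for each of them. -/
theorem reducible_of_attach {θ : List ℝ} {S S₀ S₁ : List Sig}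
    {I : (Data → Data) → Data → Data} (hI : PolyTime I)
    (hI' : ∀ q O, Solves θ q O (Holant S₀) → ∀ d r, Holant S₁ d r → IsName θ (I O d) r)
    {ex : Data → Vertex → Vertex} {exD : Data → Data} (hex : PolyTime fun _ => exD)
    (hex' : ∀ d v, exD (.cons d v.toData) = (ex d v).toData)
    {en : Vertex → Data} {enD : Data → Data} (hen : PolyTime fun _ => enD)
    (hen' : ∀ v, enD v.toData = en v) {mk : Data → Data → Data → Vertex}
    (hmk : PolyTime fun _ x => (mk x.fst x.snd.fst x.snd.snd).toData)
    (hsize : ∀ e₁ e₂ e₃, (mk e₁ e₂ e₃).toData.size ≤ e₁.size + e₂.size + e₃.size + 20)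
    {C : ℝ} (hC : C ≠ 0) {Cd : Data} (hCd : IsName θ Cd C)
    (h : ∀ Ω : Grid, Ω.WellFormed S → ∀ d, (∀ e ∈ Ω.lEnds, e.size < d.size) →
      3 ∣ (Ω.flatMap (newEnds ex en d)).length ∧
      ∀ T : List (Data × Data × Data), (Ω.flatMap (newEnds ex en d)).Perm (T.flatMap ends) →
        Grid.WellFormed S₁ (attach mk T ++ Ω.map (ex d)) ∧
          holant S₁ (attach mk T ++ Ω.map (ex d)) = holant S Ω * C ^ T.length) :
    PolyTimeTuringReducible θ (Holant S) (Holant S₀) := by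
  -- the grid with the straddled vertices, and the list of the ternary vertices at their new ends
  let mapped : Data → Data := fun d => flatMapD (fun x => .cons (exD x) .nil) d d
  let grouped : Data → Data := fun d => (groupD mk (flatMapD (fun x =>
    if x.snd.fst.snd = .nil then .nil else .cons (enD x.snd) .nil) .nil (mapped d))).snd
  have hmapped : PolyTime fun _ => mapped := .flatMapD (.cons hex .nil) .id .id
  have hgrouped : PolyTime fun _ => grouped := (PolyTime.groupD hmk hsize (.flatMapD
    (.ite PolyTime.id.snd.fst.snd .nil (.cons (hen.comp PolyTime.id.snd) .nil)) .nil hmapped)).snd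
  refine PolyTime.reducible (F := fun O d =>
    divF (I O (appendD (grouped d) (mapped d))) (powF Cd (grouped d)))
    (.divF (hI.comp (.appendD hgrouped hmapped)) (.powF (.const _) hgrouped)) ?_
  rintro q O hO _ _ ⟨Ω, hΩ, rfl, rfl⟩
  set d := Ω.toData with hd
  obtain ⟨h3, hT⟩ := h Ω hΩ d fun e he => Grid.size_lt_of_mem_lEnds he
  set X := Ω.flatMap (newEnds ex en d) with hX
  obtain ⟨hwf, hval⟩ := hT _ (perm_flatMap_group h3)
  have e1 : mapped d = Grid.toData (Ω.map (ex d)) := by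
    refine (flatMapD_ofList _ d Vertex.toData (fun v => [(ex d v).toData]) Ω fun v _ => ?_).trans ?_
    · rw [hex']; rfl
    · rw [Grid.toData, List.map_map]
      exact congrArg Data.ofList List.map_eq_flatMap.symm
  have e2 : grouped d = (attach mk (group X).2).toData := by
    have : flatMapD (fun x => if x.snd.fst.snd = .nil then .nil else .cons (enD x.snd) .nil) .nil
        (mapped d) = .ofList X := by
      rw [e1, Grid.toData, flatMapD_ofList _ _ Vertex.toData
        (fun v => if v.label < 2 then [] else [en v]), hX, List.flatMap_map]
      · rfl
      · intro v _
        have : v.toData.fst.snd = .nil ↔ v.label < 2 := ofNat_snd_eq_nil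
        simp only [Data.snd_cons, this, hen']
        split <;> rfl
    change (groupD mk (flatMapD _ _ (mapped d))).snd = _
    rw [this, groupD_ofList, Data.snd_cons]
  have e3 : appendD (grouped d) (mapped d) =
      Grid.toData (attach mk (group X).2 ++ Ω.map (ex d)) := by
    rw [e1, e2, Grid.toData, Grid.toData, appendD_ofList, ← List.map_append, Grid.toData]
  have e4 : (grouped d).len = (group X).2.length := by
    rw [e2, Grid.toData, len_ofList, List.length_map, attach, List.length_map]
  have h1 := hI' q O hO _ _ ⟨_, hwf, rfl, rfl⟩
  have h2 := h1.div (hCd.pow (grouped d)) (pow_ne_zero _ hC)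
  rw [hval, e4, mul_div_cancel_right₀ _ (pow_ne_zero _ hC), ← e3] at h2
  exact h2

theorem flatMap_length_modEq {α β γ : Type*} {L : List α} {f : α → List β} {g : α → List γ}
    {n : ℕ} (h : ∀ v ∈ L, (f v).length ≡ (g v).length [MOD n]) :
    (L.flatMap f).length ≡ (L.flatMap g).length [MOD n] := by
  induction L with
  | nil => rfl
  | cons v L ih =>
    simp only [List.flatMap_cons, List.length_append]
    exact (h v List.mem_cons_self).add (ih fun u hu => h u (List.mem_cons_of_mem _ hu))

theorem flatMap_sublist {α β : Type*} {L : List α} {f g : α → List β}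
    (h : ∀ v ∈ L, (f v).Sublist (g v)) : (L.flatMap f).Sublist (L.flatMap g) := by
  induction L with
  | nil => simp
  | cons v L ih =>
    simp only [List.flatMap_cons]
    exact (h v List.mem_cons_self).append (ih fun u hu => h u (List.mem_cons_of_mem _ hu))

/-- New ends that are named after the distinct edges `E` are distinct and new. -/
theorem nodup_of_sublist_map {E X : List Data} {d : Data} (hE : E.Nodup)
    (h : X.Sublist (E.map (Data.cons d))) :
    X.Nodup ∧ ∀ e ∈ X, d.size < e.size := by
  refine ⟨h.nodup (hE.map fun _ _ h => (Data.cons.inj h).2), fun e he => ?_⟩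
  obtain ⟨e', -, rfl⟩ := List.mem_map.1 (h.subset he)
  simp only [Data.size]
  omega

theorem rEnds_attach_rVertex (T : List (Data × Data × Data)) :
    (attach rVertex T).rEnds = T.flatMap ends ∧ (attach rVertex T).lEnds = [] := by
  induction T with
  | nil => exact ⟨rfl, rfl⟩
  | cons t T ih => exact ⟨congrArg (ends t ++ ·) ih.1, ih.2⟩

theorem lEnds_attach_lVertex (T : List (Data × Data × Data)) :
    (attach lVertex T).lEnds = T.flatMap ends ∧ (attach lVertex T).rEnds = [] := by
  induction T with
  | nil => exact ⟨rfl, rfl⟩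
  | cons t T ih => exact ⟨congrArg (ends t ++ ·) ih.1, ih.2⟩

theorem size_lVertex_le (e₁ e₂ e₃ : Data) :
    (lVertex e₁ e₂ e₃).toData.size ≤ e₁.size + e₂.size + e₃.size + 20 := by
  simp only [lVertex, Vertex.toData, Data.ofNat, Data.ofList, Data.size]
  omega

theorem size_rVertex_le (e₁ e₂ e₃ : Data) :
    (rVertex e₁ e₂ e₃).toData.size ≤ e₁.size + e₂.size + e₃.size + 20 := by
  simp only [rVertex, Vertex.toData, Data.ofNat, Data.ofList, Data.size]
  omega

theorem weight_label_lt_two {f g s s' : Sig} {v : Vertex} (h : v.label < 2) (σ : Data → Bool) :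
    v.weight [f, g, s] σ = v.weight [f, g, s'] σ := by
  obtain ⟨n, l, r⟩ := v
  match n, h with
  | 0, _ => rfl
  | 1, _ => rfl

theorem Vertex.Fits.of_label_lt_two {f g s : Sig} {v : Vertex} (h : v.Fits [f, g]) :
    v.Fits [f, g, s] := by
  obtain ⟨n, l, r⟩ := v
  obtain ⟨t, ht, h⟩ := h
  match n, ht with
  | 0, ht => exact ⟨t, ht, h⟩
  | 1, ht => exact ⟨t, ht, h⟩

/-- The ends of a vertex with a ternary signature come in threes. -/
theorem Vertex.Fits.length_modEq {f g : Sig} {v : Vertex} (hf : f.l = 3 ∧ f.r = 0)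
    (hg : g.l = 0 ∧ g.r = 3) (h : v.Fits [f, g]) :
    v.lEnds.length ≡ 0 [MOD 3] ∧ v.rEnds.length ≡ 0 [MOD 3] := by
  obtain ⟨n, l, r⟩ := v
  obtain ⟨t, ht, h1, h2⟩ := h
  match n, ht with
  | 0, ht =>
    obtain rfl : f = t := by simpa using ht
    simp only [hf] at h1 h2
    rw [h1, h2]
    decide
  | 1, ht =>
    obtain rfl : g = t := by simpa using ht
    simp only [hg] at h1 h2
    rw [h1, h2]
    decide

/-- The straddled vertex that replaces a unary one on the RHS. -/
def splitRight (d : Data) (v : Vertex) : Vertex :=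
  if v.label < 2 then v else ⟨2, [.cons d (v.rEnds.headD .nil)], v.rEnds⟩

/-- The straddled vertex that replaces a unary one on the LHS, if the signatures are listed as
`[f, u, g]` with the unary signature `u`. The other vertices are relabelled. -/
def splitLeft (d : Data) (v : Vertex) : Vertex :=
  if v.label = 0 then v else if v.label < 2 then ⟨2, v.lEnds, [.cons d (v.lEnds.headD .nil)]⟩
  else ⟨1, v.lEnds, v.rEnds⟩

theorem splitRight_cases {f g : Sig} {x : ℝ} {v : Vertex} (d : Data)
    (hv : v.Fits [f, g, symRight [1, x]]) :
    (v.label < 2 ∧ v.Fits [f, g] ∧ splitRight d v = v ∧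
      newEnds splitRight (fun v => v.lEnds.headD .nil) d v = []) ∨
    ∃ e, v = ⟨2, [], [e]⟩ ∧ splitRight d v = ⟨2, [.cons d e], [e]⟩ ∧
      newEnds splitRight (fun v => v.lEnds.headD .nil) d v = [.cons d e] := by
  rcases hv.cases with ⟨h, h'⟩ | ⟨h, h1, h2⟩
  · exact Or.inl ⟨h, h', by simp [splitRight, h], by simp [newEnds, splitRight, h]⟩
  · obtain ⟨e, he⟩ := List.length_eq_one_iff.1 h2
    obtain ⟨n, l, r⟩ := v
    simp only at h h1 he
    obtain rfl := List.length_eq_zero_iff.1 h1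
    subst h he
    exact Or.inr ⟨e, rfl, by simp [splitRight], by simp [newEnds, splitRight]⟩

/-- The unary signature `[1, x]` on the RHS is obtained from the degenerate straddled signature with
matrix `κ (y, 1)ᵀ (1, x)`: the variable on the LHS contributes the factor `κ (y, 1)`, and the edges
attached to three such variables end in one copy of `g`. -/
theorem holant_splitRight {f g : Sig} (hf : f.l = 3 ∧ f.r = 0) (hg : g.l = 0 ∧ g.r = 3)
    {κ x y C : ℝ}
    (hC : ∑ i : Bool, ∑ j : Bool, ∑ k : Bool, (κ * if i then 1 else y) * (κ * if j then 1 else y) *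
      (κ * if k then 1 else y) * g.val [] [i, j, k] = C)
    {Ω : Grid} (hΩ : Ω.WellFormed [f, g, symRight [1, x]]) (d : Data)
    (hd : ∀ e ∈ Ω.lEnds, e.size < d.size) :
    3 ∣ (Ω.flatMap (newEnds splitRight (fun v => v.lEnds.headD .nil) d)).length ∧
    ∀ T : List (Data × Data × Data),
      (Ω.flatMap (newEnds splitRight (fun v => v.lEnds.headD .nil) d)).Perm (T.flatMap ends) →
      Grid.WellFormed [f, g, straddled (κ • !![y, x * y; 1, x])]
        (attach rVertex T ++ Ω.map (splitRight d)) ∧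
      holant [f, g, straddled (κ • !![y, x * y; 1, x])]
        (attach rVertex T ++ Ω.map (splitRight d)) =
          holant [f, g, symRight [1, x]] Ω * C ^ T.length := by
  have hcase := fun v hv => splitRight_cases d (hΩ.1 v hv)
  have hsub : (Ω.flatMap (newEnds splitRight (fun v => v.lEnds.headD .nil) d)).Sublist
      (Ω.rEnds.map (Data.cons d)) := by
    rw [Grid.rEnds, List.map_flatMap]
    refine flatMap_sublist fun v hv => ?_
    rcases hcase v hv with ⟨-, -, -, h⟩ | ⟨e, rfl, -, h⟩ <;> rw [h] <;> simp
  obtain ⟨hn, hnew⟩ := nodup_of_sublist_map (hΩ.2.2.nodup_iff.1 hΩ.2.1) hsub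
  refine ⟨?_, fun T hT => holant_attach hΩ _ _ hT ?_ ?_ ?_ ?_ hn ?_
    (fun b => κ * if b then 1 else y) ?_ ?_ ?_⟩
  · have h1 : Ω.rEnds.length ≡
        (Ω.flatMap (newEnds splitRight (fun v => v.lEnds.headD .nil) d)).length [MOD 3] :=
      flatMap_length_modEq fun v hv => by
        rcases hcase v hv with ⟨-, h, -, h'⟩ | ⟨e, rfl, -, h'⟩ <;> rw [h']
        · exact (h.length_modEq hf hg).2
        · rfl
    have h2 : Ω.lEnds.length ≡ (Ω.flatMap fun _ => ([] : List Data)).length [MOD 3] :=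
      flatMap_length_modEq fun v hv => by
        rcases hcase v hv with ⟨-, h, -, h'⟩ | ⟨e, rfl, -, h'⟩
        · exact (h.length_modEq hf hg).1
        · rfl
    rw [← hΩ.2.2.length_eq] at h1
    refine (Nat.modEq_zero_iff_dvd).1 ((h1.symm.trans h2).trans ?_)
    simp [Nat.ModEq]
  · intro v hv
    rcases hcase v hv with ⟨-, h, h', -⟩ | ⟨e, rfl, h', -⟩ <;> rw [h']
    · exact h.of_label_lt_two
    · exact ⟨_, rfl, rfl, rfl⟩
  · exact fun _ _ _ => ⟨g, rfl, hg.1.symm, hg.2.symm⟩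
  · rw [Grid.lEnds_append, (rEnds_attach_rVertex T).2, List.nil_append, Grid.lEnds,
      List.flatMap_map]
    refine (flatMap_perm_of_perm fun v hv => ?_).trans (flatMap_append_perm Ω Vertex.lEnds _)
    rcases hcase v hv with ⟨-, -, h, h'⟩ | ⟨e, rfl, h, h'⟩ <;> rw [h, h'] <;> simp
  · rw [Grid.rEnds_append, (rEnds_attach_rVertex T).1]
    refine (hT.symm.append ?_).trans List.perm_append_comm
    rw [Grid.rEnds, List.flatMap_map]
    refine flatMap_perm_of_perm fun v hv => ?_
    rcases hcase v hv with ⟨-, -, h, h'⟩ | ⟨e, rfl, h, h'⟩ <;> rw [h]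
  · exact fun e he he' => absurd (hd e he') (hnew e he).le.not_gt
  · intro v hv σ
    rcases hcase v hv with ⟨h2, -, h, h'⟩ | ⟨e, rfl, h, h'⟩ <;> rw [h, h']
    · rw [List.map_nil, List.prod_nil, mul_one, weight_label_lt_two h2]
    · cases h1 : σ e <;> cases h2 : σ (.cons d e) <;>
        simp [Vertex.weight, straddled, symRight, bit, h1, h2] <;> ring
  · intro e₁ e₂ e₃ σ τ h
    simp only [Vertex.weight, rVertex, List.map_cons, List.map_nil, h e₁ (by simp),
      h e₂ (by simp), h e₃ (by simp)]
  · intro e₁ e₂ e₃ h12 h13 h23 σ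
    rw [← hC]
    simp [sumE, Vertex.weight, rVertex, Function.update_of_ne, h12, h13, h23]
    ring

theorem splitLeft_cases {f g : Sig} {y : ℝ} {v : Vertex} (d : Data)
    (hv : v.Fits [f, symLeft [y, 1], g]) :
    ((splitLeft d v).label < 2 ∧ (splitLeft d v).Fits [f, g] ∧
      (splitLeft d v).lEnds = v.lEnds ∧ (splitLeft d v).rEnds = v.rEnds ∧
      (∀ s σ, (splitLeft d v).weight [f, g, s] σ = v.weight [f, symLeft [y, 1], g] σ) ∧
      newEnds splitLeft (fun v => v.rEnds.headD .nil) d v = []) ∨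
    ∃ e, v = ⟨1, [e], []⟩ ∧ splitLeft d v = ⟨2, [e], [.cons d e]⟩ ∧
      newEnds splitLeft (fun v => v.rEnds.headD .nil) d v = [.cons d e] := by
  obtain ⟨n, l, r⟩ := v
  obtain ⟨t, ht, h1, h2⟩ := hv
  match n, ht with
  | 0, ht => exact Or.inl ⟨Nat.zero_lt_two, ⟨t, ht, h1, h2⟩, rfl, rfl, fun _ _ => rfl, rfl⟩
  | 1, ht =>
    obtain rfl : symLeft [y, 1] = t := by simpa using ht
    obtain ⟨e, rfl⟩ := List.length_eq_one_iff.1 h1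
    obtain rfl := List.length_eq_zero_iff.1 h2
    exact Or.inr ⟨e, rfl, rfl, rfl⟩
  | 2, ht => exact Or.inl ⟨Nat.one_lt_two, ⟨t, ht, h1, h2⟩, rfl, rfl, fun _ _ => rfl, rfl⟩

/-- The unary signature `[y, 1]` on the LHS is obtained from the same straddled signature: its
variable on the RHS contributes the factor `κ (1, x)`, and the edges attached to three such
variables end in one copy of `f`. -/
theorem holant_splitLeft {f g : Sig} (hf : f.l = 3 ∧ f.r = 0) (hg : g.l = 0 ∧ g.r = 3)
    {κ x y C : ℝ}
    (hC : ∑ i : Bool, ∑ j : Bool, ∑ k : Bool, (κ * if i then x else 1) * (κ * if j then x else 1) *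
      (κ * if k then x else 1) * f.val [i, j, k] [] = C)
    {Ω : Grid} (hΩ : Ω.WellFormed [f, symLeft [y, 1], g]) (d : Data)
    (hd : ∀ e ∈ Ω.lEnds, e.size < d.size) :
    3 ∣ (Ω.flatMap (newEnds splitLeft (fun v => v.rEnds.headD .nil) d)).length ∧
    ∀ T : List (Data × Data × Data),
      (Ω.flatMap (newEnds splitLeft (fun v => v.rEnds.headD .nil) d)).Perm (T.flatMap ends) →
      Grid.WellFormed [f, g, straddled (κ • !![y, x * y; 1, x])]
        (attach lVertex T ++ Ω.map (splitLeft d)) ∧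
      holant [f, g, straddled (κ • !![y, x * y; 1, x])]
        (attach lVertex T ++ Ω.map (splitLeft d)) =
          holant [f, symLeft [y, 1], g] Ω * C ^ T.length := by
  have hcase := fun v hv => splitLeft_cases d (hΩ.1 v hv)
  have hsub : (Ω.flatMap (newEnds splitLeft (fun v => v.rEnds.headD .nil) d)).Sublist
      (Ω.lEnds.map (Data.cons d)) := by
    rw [Grid.lEnds, List.map_flatMap]
    refine flatMap_sublist fun v hv => ?_
    rcases hcase v hv with ⟨-, -, -, -, -, h⟩ | ⟨e, rfl, -, h⟩ <;> rw [h] <;> simp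
  obtain ⟨hn, hnew⟩ := nodup_of_sublist_map hΩ.2.1 hsub
  refine ⟨?_, fun T hT => holant_attach hΩ _ _ hT ?_ ?_ ?_ ?_ hn ?_
    (fun b => κ * if b then x else 1) ?_ ?_ ?_⟩
  · have h1 : Ω.lEnds.length ≡
        (Ω.flatMap (newEnds splitLeft (fun v => v.rEnds.headD .nil) d)).length [MOD 3] :=
      flatMap_length_modEq fun v hv => by
        rcases hcase v hv with ⟨-, h, h1, -, -, h'⟩ | ⟨e, rfl, -, h'⟩ <;> rw [h']
        · rw [← h1]; exact (h.length_modEq hf hg).1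
        · rfl
    have h2 : Ω.rEnds.length ≡ (Ω.flatMap fun _ => ([] : List Data)).length [MOD 3] :=
      flatMap_length_modEq fun v hv => by
        rcases hcase v hv with ⟨-, h, -, h1, -, h'⟩ | ⟨e, rfl, -, h'⟩
        · rw [← h1]; exact (h.length_modEq hf hg).2
        · rfl
    rw [hΩ.2.2.length_eq] at h1
    refine (Nat.modEq_zero_iff_dvd).1 ((h1.symm.trans h2).trans ?_)
    simp [Nat.ModEq]
  · intro v hv
    rcases hcase v hv with ⟨-, h, -⟩ | ⟨e, rfl, h', -⟩
    · exact h.of_label_lt_two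
    · rw [h']; exact ⟨_, rfl, rfl, rfl⟩
  · exact fun _ _ _ => ⟨f, rfl, hf.1.symm, hf.2.symm⟩
  · rw [Grid.lEnds_append, (lEnds_attach_lVertex T).1]
    refine (hT.symm.append ?_).trans List.perm_append_comm
    rw [Grid.lEnds, List.flatMap_map]
    refine flatMap_perm_of_perm fun v hv => ?_
    rcases hcase v hv with ⟨-, -, h, -⟩ | ⟨e, rfl, h, h'⟩ <;> rw [h]
  · rw [Grid.rEnds_append, (lEnds_attach_lVertex T).2, List.nil_append, Grid.rEnds,
      List.flatMap_map]
    refine (flatMap_perm_of_perm fun v hv => ?_).trans (flatMap_append_perm Ω Vertex.rEnds _)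
    rcases hcase v hv with ⟨-, -, -, h, -, h'⟩ | ⟨e, rfl, h, h'⟩ <;> rw [h, h'] <;> simp
  · exact fun e he he' => absurd (hd e he') (hnew e he).le.not_gt
  · intro v hv σ
    rcases hcase v hv with ⟨-, -, -, -, h, h'⟩ | ⟨e, rfl, h, h'⟩ <;> rw [h, h']
    · rw [List.map_nil, List.prod_nil, mul_one]
    · cases h1 : σ e <;> cases h2 : σ (.cons d e) <;>
        simp [Vertex.weight, straddled, symLeft, bit, h1, h2] <;> ring
  · intro e₁ e₂ e₃ σ τ h
    simp only [Vertex.weight, lVertex, List.map_cons, List.map_nil, h e₁ (by simp),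
      h e₂ (by simp), h e₃ (by simp)]
  · intro e₁ e₂ e₃ h12 h13 h23 σ
    rw [← hC]
    simp [sumE, Vertex.weight, lVertex, Function.update_of_ne, h12, h13, h23]
    ring

theorem polyTime_splitRight : ∃ exD : Data → Data, PolyTime (fun _ => exD) ∧
    ∀ d v, exD (.cons d v.toData) = (splitRight d v).toData := by
  refine ⟨fun x => if x.snd.fst.snd = .nil then x.snd else .cons (.ofNat 2)
    (.cons (.cons (.cons x.fst x.snd.snd.snd.fst) .nil) x.snd.snd.snd),
    .ite PolyTime.id.snd.fst.snd PolyTime.id.snd (.cons (.const _)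
      (.cons (.cons (.cons PolyTime.id.fst PolyTime.id.snd.snd.snd.fst) .nil)
        PolyTime.id.snd.snd.snd)), fun d v => ?_⟩
  have h₁ : v.toData.fst.snd = .nil ↔ v.label < 2 := ofNat_snd_eq_nil
  have h₂ : v.toData.snd.snd.fst = v.rEnds.headD .nil := ofList_fst _
  simp only [Data.fst_cons, Data.snd_cons, h₁, h₂, splitRight]
  split <;> rfl

theorem polyTime_splitLeft : ∃ exD : Data → Data, PolyTime (fun _ => exD) ∧
    ∀ d v, exD (.cons d v.toData) = (splitLeft d v).toData := by
  refine ⟨fun x => if x.snd.fst = .nil then x.snd else if x.snd.fst.snd = .nil then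
      .cons (.ofNat 2) (.cons x.snd.snd.fst (.cons (.cons x.fst x.snd.snd.fst.fst) .nil))
    else .cons (.ofNat 1) x.snd.snd,
    .ite PolyTime.id.snd.fst PolyTime.id.snd (.ite PolyTime.id.snd.fst.snd
      (.cons (.const _) (.cons PolyTime.id.snd.snd.fst
        (.cons (.cons PolyTime.id.fst PolyTime.id.snd.snd.fst.fst) .nil)))
      (.cons (.const _) PolyTime.id.snd.snd)), fun d v => ?_⟩
  have h₀ : v.toData.fst = .nil ↔ v.label = 0 := Data.ofNat_injective.eq_iff (b := 0)
  have h₁ : v.toData.fst.snd = .nil ↔ v.label < 2 := ofNat_snd_eq_nil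
  have h₂ : v.toData.snd.fst.fst = v.lEnds.headD .nil := ofList_fst _
  simp only [Data.fst_cons, Data.snd_cons, h₀, h₁, h₂, splitLeft]
  split
  · rfl
  · split <;> rfl

/-! ### The spectral decomposition of the binary gadget -/

/-- The signature matrix of the binary gadget built from `[1, a, b, c]` and `(=₃)`. -/
theorem gadgetG1_symLeft_eq3 (a b c : ℝ) :
    gadgetG1 (symLeft [1, a, b, c]) eq3 = !![1, b; a, c] := by
  ext i j
  fin_cases i <;> fin_cases j <;> simp [gadgetG1, symLeft, eq3, symRight]

/-- The matrix with eigenvectors `(-x, 1)`, `(y, 1)` and eigenvalues `l`, `m`. -/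
theorem conj_diagonal {x y : ℝ} (h : x + y ≠ 0) (l m : ℝ) :
    !![-x, y; 1, 1] * Matrix.diagonal ![l, m] * (!![-x, y; 1, 1])⁻¹ =
      (x + y)⁻¹ • !![x * l + y * m, x * y * (m - l); m - l, y * l + x * m] := by
  have hinv : (!![-x, y; 1, 1] : Matrix (Fin 2) (Fin 2) ℝ)⁻¹ =
      (x + y)⁻¹ • !![-1, y; 1, x] := by
    refine Matrix.inv_eq_right_inv ?_
    ext i j
    fin_cases i <;> fin_cases j <;> simp [Matrix.mul_apply] <;> field_simp <;> ring
  have hdiag : Matrix.diagonal ![l, m] = !![l, 0; 0, m] := by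
    ext i j
    fin_cases i <;> fin_cases j <;> rfl
  rw [hinv, hdiag, Matrix.mul_smul]
  congr 1
  ext i j
  fin_cases i <;> fin_cases j <;> simp [Matrix.mul_apply, Fin.sum_univ_two] <;> ring

/-- The powers of a diagonalizable matrix with eigenvalues `l` and `m ≠ 0`. -/
theorem pow_conj_diagonal {P : Matrix (Fin 2) (Fin 2) ℝ} (hP : IsUnit P.det) {l m : ℝ}
    (hm : m ≠ 0) (k : ℕ) : (P * Matrix.diagonal ![l, m] * P⁻¹) ^ k = m ^ k •
      (P * Matrix.diagonal ![0, 1] * P⁻¹ + (l / m) ^ k • (P * Matrix.diagonal ![1, 0] * P⁻¹)) := by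
  have h1 : ∀ k, (P * Matrix.diagonal ![l, m] * P⁻¹) ^ k =
      P * Matrix.diagonal ![l, m] ^ k * P⁻¹ := by
    intro k
    induction k with
    | zero => simp [Matrix.mul_nonsing_inv P hP]
    | succ k ih =>
      rw [pow_succ, ih, pow_succ]
      simp only [← Matrix.mul_assoc]
      rw [Matrix.nonsing_inv_mul_cancel_right _ _ hP]
  have h2 : Matrix.diagonal ![l, m] ^ k =
      m ^ k • (Matrix.diagonal ![0, 1] + (l / m) ^ k • Matrix.diagonal ![1, 0]) := by
    rw [Matrix.diagonal_pow]
    ext i j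
    fin_cases i <;> fin_cases j <;> simp [div_pow]
    field_simp
  rw [h1, h2]
  simp only [Matrix.mul_smul, Matrix.smul_mul, Matrix.mul_add, Matrix.add_mul]

end BipHolant

open BipHolant
theorem mainTheorem4 (a b c : ℝ) (ha : 0 ≤ a) (hb : 0 ≤ b) (hc : 0 ≤ c) (ha0 : a ≠ 0)
    (Δ : ℝ) (hΔ : Δ = Real.sqrt ((1 - c) ^ 2 + 4 * a * b)) (hΔ0 : 0 < Δ)
    (x y : ℝ) (hx : x = (Δ - (1 - c)) / (2 * a)) (hy : y = (Δ + (1 - c)) / (2 * a))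
    (P D : Matrix (Fin 2) (Fin 2) ℝ) (hP : P = !![-x, y; 1, 1])
    (hD : D = P * Matrix.diagonal ![0, 1] * P⁻¹) :
    -- the gadget built from `[1,a,b,c]` and `(=₃)`, and its eigenvectors
    gadgetG1 (symLeft [1, a, b, c]) eq3 = !![1, b; a, c] ∧
    IsUnit P.det ∧
    !![1, b; a, c] =
      P * Matrix.diagonal ![(-Δ + (1 + c)) / 2, (Δ + (1 + c)) / 2] * P⁻¹ ∧
    -- the straddled signature built from the eigenvectors is degenerate and can be interpolated
    D = (x + y)⁻¹ • !![y, x * y; 1, x] ∧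
    D.det = 0 ∧
    PolyTimeTuringReducible [a, b, c, Δ]
      (Holant [symLeft [1, a, b, c], eq3, straddled D])
      (Holant [symLeft [1, a, b, c], eq3]) ∧
    -- the unary signature `[1,x]` on the RHS
    PolyTimeTuringReducible [a, b, c, Δ]
      (Holant [symLeft [1, a, b, c], eq3, symRight [1, x]])
      (Holant [symLeft [1, a, b, c], eq3]) ∧
    -- the unary signature `[y,1]` on the LHS
    PolyTimeTuringReducible [a, b, c, Δ]
      (Holant [symLeft [1, a, b, c], symLeft [y, 1], eq3])
      (Holant [symLeft [1, a, b, c], eq3]) := by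
  have ha1 : 0 < a := lt_of_le_of_ne ha ha0.symm
  have hsq : Δ ^ 2 = (1 - c) ^ 2 + 4 * a * b := by
    rw [hΔ, Real.sq_sqrt (by positivity)]
  have habs : |1 - c| ≤ Δ := by
    rw [hΔ]
    exact Real.abs_le_sqrt (by nlinarith [mul_nonneg ha hb])
  obtain ⟨hle1, hle2⟩ := abs_le.1 habs
  have hx0 : 0 ≤ x := by rw [hx]; exact div_nonneg (by linarith) (by linarith)
  have hy0 : 0 ≤ y := by rw [hy]; exact div_nonneg (by linarith) (by linarith)
  have hxy : x + y = Δ / a := by rw [hx, hy]; field_simp; ring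
  have hs : x + y ≠ 0 := by rw [hxy]; exact (div_pos hΔ0 ha1).ne'
  have hdet : IsUnit P.det := by
    rw [hP, Matrix.det_fin_two_of, isUnit_iff_ne_zero]
    intro h
    exact hs (by linarith)
  have hax : 2 * a * x = Δ - (1 - c) := by rw [hx]; field_simp
  have hay : 2 * a * y = Δ + (1 - c) := by rw [hy]; field_simp
  have haxy : a * (x * y) = b := by
    have : 4 * a * (a * (x * y)) = 4 * a * b := by
      rw [show 4 * a * (a * (x * y)) = (2 * a * x) * (2 * a * y) by ring, hax, hay]
      linear_combination hsq
    exact mul_left_cancel₀ (by positivity) this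
  have hspec : !![1, b; a, c] =
      P * Matrix.diagonal ![(-Δ + (1 + c)) / 2, (Δ + (1 + c)) / 2] * P⁻¹ := by
    have e1 : (-Δ + (1 + c)) / 2 = 1 - a * y := by linarith
    have e2 : (Δ + (1 + c)) / 2 = 1 + a * x := by linarith
    have e3 : c = 1 + a * x - a * y := by linarith
    rw [hP, conj_diagonal hs, e1, e2, ← haxy, e3]
    ext i j
    fin_cases i <;> fin_cases j <;> simp <;> field_simp <;> ring
  have hDm : D = (x + y)⁻¹ • !![y, x * y; 1, x] := by
    rw [hD, hP, conj_diagonal hs]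
    simp
  have hG := gadgetG1_symLeft_eq3 a b c
  set f := symLeft [1, a, b, c] with hf
  set θ := [a, b, c, Δ] with hθ
  set l := (-Δ + (1 + c)) / 2 with hl
  set m := (Δ + (1 + c)) / 2 with hm
  have hm0 : 0 < m := by rw [hm]; linarith
  have hρ : |l / m| < 1 := by
    rw [abs_div, abs_of_pos hm0, div_lt_one hm0, abs_lt]
    constructor <;> rw [hl, hm] <;> linarith
  -- names of the constants
  have na : IsName θ _ a := .const (i := 0) rfl
  have nb : IsName θ _ b := .const (i := 1) rfl
  have nc : IsName θ _ c := .const (i := 2) rfl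
  have nΔ : IsName θ _ Δ := .const (i := 3) rfl
  have n1 : IsName θ _ 1 := .one
  have n2 := n1.add n1
  rw [one_add_one_eq_two] at n2
  have nm := (nΔ.add (n1.add nc)).div n2 two_ne_zero
  rw [← hm] at nm
  have nl := ((n1.add nc).sub nΔ).div n2 two_ne_zero
  rw [show (1 + c - Δ) / 2 = l by rw [hl]; ring] at nl
  have nρ := nl.div nm hm0.ne'
  have nx := (nΔ.sub (n1.sub nc)).div (n2.mul na) (by positivity)
  rw [← hx] at nx
  have ny := (nΔ.add (n1.sub nc)).div (n2.mul na) (by positivity)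
  rw [← hy] at ny
  have nκ := n1.div (nx.add ny) hs
  rw [one_div] at nκ
  set κ := (x + y)⁻¹ with hκ
  have hκ0 : κ ≠ 0 := inv_ne_zero hs
  have hf3 : f.l = 3 ∧ f.r = 0 := ⟨rfl, rfl⟩
  have hg3 : eq3.l = 0 ∧ eq3.r = 3 := ⟨rfl, rfl⟩
  have hI : ∀ q O, Solves θ q O (Holant [f, eq3]) → ∀ d r, Holant [f, eq3, straddled D] d r →
      IsName θ (interpolateF _ _ O d) r := fun q O hO d r h =>
    isName_interpolateF hf3 hg3 hρ hm0.ne'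
      (fun k => by rw [hG, hspec, pow_conj_diagonal hdet hm0.ne', ← hD]) nρ nm hO h
  have hP0 := PolyTime.interpolateF
  refine ⟨hG, hdet, hspec, hDm, ?_, (hP0 _ _).reducible hI, ?_, ?_⟩
  · rw [hDm, Matrix.det_smul, Matrix.det_fin_two_of]
    ring
  · obtain ⟨exD, h1, h2⟩ := polyTime_splitRight
    refine reducible_of_attach (hP0 _ _) hI h1 h2 (en := fun v => v.lEnds.headD .nil)
      PolyTime.id.snd.fst.fst (fun v => ofList_fst _)
      (.rVertex PolyTime.id.fst PolyTime.id.snd.fst PolyTime.id.snd.snd) size_rVertex_le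
      (C := κ * κ * κ * (y * y * y + 1)) ?_
      (((nκ.mul nκ).mul nκ).mul (((ny.mul ny).mul ny).add n1)) fun Ω hΩ d hd => ?_
    · exact mul_ne_zero (by positivity) (by positivity)
    · rw [hDm]
      refine holant_splitRight hf3 hg3 ?_ hΩ d hd
      simp [eq3, symRight]
      ring
  · obtain ⟨exD, h1, h2⟩ := polyTime_splitLeft
    refine reducible_of_attach (hP0 _ _) hI h1 h2 (en := fun v => v.rEnds.headD .nil)
      PolyTime.id.snd.snd.fst (fun v => ofList_fst _)
      (.lVertex PolyTime.id.fst PolyTime.id.snd.fst PolyTime.id.snd.snd) size_lVertex_le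
      (C := κ * κ * κ * (1 + (1 + 2) * (a * x) + (1 + 2) * (b * x * x) + c * x * x * x)) ?_
      (((nκ.mul nκ).mul nκ).mul (((n1.add ((n1.add n2).mul (na.mul nx))).add
        ((n1.add n2).mul ((nb.mul nx).mul nx))).add (((nc.mul nx).mul nx).mul nx)))
      fun Ω hΩ d hd => ?_
    · exact mul_ne_zero (by positivity) (by positivity)
    · rw [hDm]
      refine holant_splitLeft hf3 hg3 ?_ hΩ d hd
      simp [hf, symLeft]
      ring
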